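/- **Setting.** Let $N=g+1\ge 1$, let $\alpha_1,\dots,\alpha_N$ be non-zero with distinct squares, $A=\mathrm{diag}(\alpha_1,\dots,\alpha_N)$, $\langle x,y\rangle=\sum_j x_jy_j$, $Q_\lambda(x,y)=\sum_j \frac{x_jy_j}{\lambda^2-\alpha_j^2}$, and for $p,q\in\mathbb C^N$ (in particular for real $p,q$) $$L(\lambda;p,q)=\begin{pmatrix}\lambda Q_\lambda(p,q)&1-Q_\lambda(Ap,p)\\ Q_\lambda(Aq,q)&-\lambda Q_\lambda(p,q)\end{pmatrix},\qquad \mathcal F_\lambda=\det L(\lambda),\qquad F_1=-\langle Aq,q\rangle-\langle p,q\rangle^2 .$$ Fix $(p_0,q_0)$ with $F_1\ne0$ and a root $\sqrt{-F_1}$. With $\zeta=\lambda^2$ and $\alpha(\zeta)=\prod_j(\zeta-\alpha_j^2)$ write $\mathcal F_\lambda(p_0,q_0)=F_1\prod_{k=1}^{g}(\zeta-\zeta_k)/\alpha(\zeta)$, put $R(\zeta)=\zeta\,\alpha(\zeta)\prod_{k=1}^g(\zeta-\zeta_k)$, and assume that $R$ has simple roots. Let $\mathcal R$ be the compact Riemann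 surface of genus $g$ of $\xi^2=R(\zeta)$, with points at infinity $\infty_\pm$ (where $\xi\sim\pm\zeta^{N}$) and branch point $\mathfrak o=(0,0)$. Let $\gamma^2\neq\alpha_j^2$ for all $j$, and fix a sign $\varepsilon=\pm1$ and $$b=f_\gamma(p,q)=\frac{-\gamma Q_\gamma(p,q)+\varepsilon\sqrt{-\mathcal F_\gamma(p,q)}}{Q_\gamma(Aq,q)},\qquad D^{(\gamma)}(\lambda,b)=\begin{pmatrix}\lambda&\gamma b\\ \gamma b^{-1}&\lambda\end{pmatrix}$$ (principal square root). Let $S_\gamma$ send $(p,q)$ to $(\tilde p,\tilde q)$, $(\tilde p_j,\tilde q_j)^T=(\alpha_j^2-\gamma^2)^{-1/2}D^{(\gamma)}(\alpha_j,b)(p_j,q_j)^T$. Put $(p(m),q(m))=S_\gamma^m(p_0,q_0)$, $b_m=f_\gamma(p(m),q(m))$ and $L_m(\lambda)=L(\lambda;p(m),q(m))$. Assume that the flow is defined up to step $m$ (i.e. $Q_\gamma(Aq(i),q(i))\ne0$ and $b_i\neq0$ for $i<m$), and that $\langle Aq(0),q(0)\rangle$ and $\langle Aq(m),q(m)\rangle$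 are non-zero. For $i\in\{0,m\}$ let $\nu_1^2(i),\dots,\nu_g^2(i)$ be the roots of $L_i^{21}$, that is $L^{21}_i(\lambda)=\langle Aq(i),q(i)\rangle\prod_{j=1}^g(\zeta-\nu_j^2(i))/\alpha(\zeta)$. **Baker functions.** Let $M(m,\lambda)=D^{(\gamma)}(\lambda,b_{m-1})\cdots D^{(\gamma)}(\lambda,b_0)$. For a point $(\lambda^2,\xi)\in\mathcal R$ put $\rho_\lambda=\sqrt{-F_1}\,\xi/(\lambda\alpha(\lambda^2))$, $c^\pm_\lambda=(L_0^{11}(\lambda)\pm\rho_\lambda)/L_0^{21}(\lambda)$, $h_\pm(m,\lambda)=M(m,\lambda)(c_\lambda^\pm,1)^T$, and let $h^{(2)}_\pm$ be the second component. The Baker functions $H^{(2)}(m,\cdot)$ are given at $(\lambda^2,\xi)$ and $(\lambda^2,-\xi)$ respectively by $h^{(2)}_+(m,\lambda)$ and $h^{(2)}_-(m,\lambda)$ if $m=2k$, and by $\lambda h^{(2)}_+(m,\lambda)$ and $\lambda h^{(2)}_-(m,\lambda)$ if $m=2k+1$. **Points.** $\mathfrak p(\nu_j^2(m))$ is the point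 of $\mathcal R$ over $\zeta=\nu_j^2(m)$ with $\sqrt{-F_1}\,\xi=\lambda\,\alpha(\lambda^2)L_m^{11}(\lambda)$ at $\lambda^2=\nu_j^2(m)$ (if $\nu_j^2(m)$ is some $\alpha_i^2$, it is the branch point $(\alpha_i^2,0)$). $\mathfrak p(\gamma^2)$ is the point over $\zeta=\gamma^2$ with $\sqrt{-F_1}\,\xi=-\varepsilon\gamma\,\alpha(\gamma^2)\sqrt{-\mathcal F_\gamma(p_0,q_0)}$. **Statement.** The functions $H^{(2)}(2k,\cdot)$ and $H^{(2)}(2k+1,\cdot)$ are well defined on $\mathcal R$ (independent of the choice of $\lambda=\zeta^{1/2}$) and meromorphic on $\mathcal R$, the above points lie on $\mathcal R$, and the divisors are, respectively, $$\sum_{j=1}^g\big[\mathfrak p(\nu_j^2(2k))-\mathfrak p(\nu_j^2(0))\big]+2k\,\mathfrak p(\gamma^2)-k(\infty_++\infty_-),$$ $$\sum_{j=1}^g\big[\mathfrak p(\nu_j^2(2k+1))-\mathfrak p(\nu_j^2(0))\big]+(2k+1)\,\mathfrak p(\gamma^2)+\mathfrak o-(k+1)(\infty_++\infty_-).$$ 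-/

import Mathlib

open Polynomial

noncomputable section

namespace LSKdV

/-! ### Hyperelliptic curves `ξ² = R(ζ)` with two points at infinity

`R` is a squarefree monic polynomial of even degree `2n`.  The compact Riemann surface consists of
the affine points and of two points at infinity `∞₊`, `∞₋`, at which `ξ ∼ ζⁿ`, `ξ ∼ -ζⁿ`. -/

/-- The points of the compact curve `ξ² = R(ζ)`; `infty 1` is `∞₊` and `infty (-1)` is `∞₋`. -/
inductive Pt (R : ℂ[X]) : Type
  | affine (ζ ξ : ℂ) (h : ξ ^ 2 = R.eval ζ) : Pt R
  | infty (s : ℤˣ) : Pt R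

/-- The branch of `√w` for `w` near `c ≠ 0` (holomorphic there) whose value at `c` is the principal
square root of `c`. -/
def sqrtNear (c w : ℂ) : ℂ := c ^ (1 / 2 : ℂ) * (w / c) ^ (1 / 2 : ℂ)

lemma sq_cpow_half (w : ℂ) : (w ^ (1 / 2 : ℂ)) ^ 2 = w := by
  have h := Complex.cpow_nat_inv_pow w (n := 2) (by norm_num)
  simp at h ⊢

lemma sqrtNear_sq {c : ℂ} (hc : c ≠ 0) (w : ℂ) : sqrtNear c w ^ 2 = w := by
  unfold sqrtNear
  rw [mul_pow, sq_cpow_half, sq_cpow_half]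
  field_simp

lemma eval_eq_sub_mul {R : ℂ[X]} {a : ℂ} (h : R.eval a = 0) (z : ℂ) :
    R.eval z = (z - a) * (R /ₘ (X - C a)).eval z := by
  conv_lhs => rw [← mul_divByMonic_eq_iff_isRoot.mpr h]
  simp

lemma quot_eval_ne_zero {R : ℂ[X]} (hR : Squarefree R) {a : ℂ} (h : R.eval a = 0) :
    (R /ₘ (X - C a)).eval a ≠ 0 := by
  intro h2
  obtain ⟨T, hT⟩ := dvd_iff_isRoot.mpr h2
  have hRT : R = (X - C a) * (X - C a) * T := by
    conv_lhs => rw [← mul_divByMonic_eq_iff_isRoot.mpr h, hT]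
    ring
  exact not_isUnit_X_sub_C a (hR (X - C a) ⟨T, hRT⟩)

/-- The inverse `t ↦ localParam P t` of the standard local coordinate `t` centred at `P`:
* `t = ζ - ζ₀` at an affine point `(ζ₀, ξ₀)` with `ξ₀ ≠ 0`;
* `t = (ζ - ζ₀)^{1/2}` at a branch point `(ζ₀, 0)`, where `ξ = t √(R(ζ) / (ζ - ζ₀))`;
* `t = 1 / ζ` at the points at infinity, where `ξ = ± t⁻ⁿ √(t²ⁿ R(1/t))`, `t²ⁿ R(1/t) → 1`. -/
def localParam {R : ℂ[X]} (hR : Squarefree R) : Pt R → ℂ → Pt R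
  | .affine ζ₀ ξ₀ h, t =>
      if hξ : ξ₀ = 0 then
        .affine (ζ₀ + t ^ 2)
          (t * sqrtNear ((R /ₘ (X - C ζ₀)).eval ζ₀) ((R /ₘ (X - C ζ₀)).eval (ζ₀ + t ^ 2))) (by
            have h0 : R.eval ζ₀ = 0 := by rw [← h, hξ]; ring
            rw [mul_pow, sqrtNear_sq (quot_eval_ne_zero hR h0), eval_eq_sub_mul h0 (ζ₀ + t ^ 2)]
            ring)
      else
        .affine (ζ₀ + t) (ξ₀ * (R.eval (ζ₀ + t) / R.eval ζ₀) ^ (1 / 2 : ℂ)) (by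
            have h0 : R.eval ζ₀ ≠ 0 := by rw [← h]; exact pow_ne_zero 2 hξ
            rw [mul_pow, sq_cpow_half, h]
            field_simp)
  | .infty s, t =>
      if ht : t = 0 then .infty s
      else
        .affine t⁻¹
          (((s : ℤ) : ℂ) * t⁻¹ ^ (R.natDegree / 2) *
            (t ^ (2 * (R.natDegree / 2)) * R.eval t⁻¹) ^ (1 / 2 : ℂ)) (by
            have hs : (((s : ℤ) : ℂ)) ^ 2 = 1 := by
              rcases Int.units_eq_one_or s with rfl | rfl <;> norm_num
            rw [mul_pow, mul_pow, sq_cpow_half, hs, ← pow_mul, mul_comm (R.natDegree / 2) 2, one_mul,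
              ← mul_assoc, ← mul_pow, inv_mul_cancel₀ ht, one_pow, one_mul])

/-- `f` is meromorphic on the compact curve: it is so in the local coordinate at every point.
(Values of `f` at isolated points are immaterial.) -/
def IsMeromorphic {R : ℂ[X]} (hR : Squarefree R) (f : Pt R → ℂ) : Prop :=
  ∀ P : Pt R, MeromorphicAt (fun t => f (localParam hR P t)) 0

/-- The order of `f` at `P` (positive at zeros, negative at poles, `⊤` if `f` vanishes near `P`). -/
def ordAt {R : ℂ[X]} (hR : Squarefree R) (f : Pt R → ℂ) (P : Pt R) : WithTop ℤ :=
  meromorphicOrderAt (fun t => f (localParam hR P t)) 0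

/-- The meromorphic function `f` has the divisor `D`. -/
def HasDivisor {R : ℂ[X]} (hR : Squarefree R) (f : Pt R → ℂ) (D : Pt R →₀ ℤ) : Prop :=
  IsMeromorphic hR f ∧ ∀ P : Pt R, ordAt hR f P = ((D P : ℤ) : WithTop ℤ)

/-! ### The Lax matrix and the map `S_γ` -/

/-- Phase space: pairs `z = (p, q)` of vectors. -/
abbrev Phase (N : ℕ) : Type := (Fin N → ℂ) × (Fin N → ℂ)

/-- `Q_λ(x, y) = ∑ⱼ xⱼ yⱼ / (λ² - αⱼ²)`. -/
def Q {N : ℕ} (α : Fin N → ℂ) (lam : ℂ) (x y : Fin N → ℂ) : ℂ :=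
  ∑ j, x j * y j / (lam ^ 2 - α j ^ 2)

/-- The Lax matrix `L(λ; p, q)`; here `α * x` is `A x` with `A = diag(α₁, …, α_N)`. -/
def L {N : ℕ} (α : Fin N → ℂ) (lam : ℂ) (z : Phase N) : Matrix (Fin 2) (Fin 2) ℂ :=
  !![lam * Q α lam z.1 z.2, 1 - Q α lam (α * z.1) z.1;
     Q α lam (α * z.2) z.2, -(lam * Q α lam z.1 z.2)]

/-- `𝓕_λ(p, q) = det L(λ; p, q)`. -/
def genF {N : ℕ} (α : Fin N → ℂ) (lam : ℂ) (z : Phase N) : ℂ := (L α lam z).det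

/-- `⟨A q, q⟩`. -/
def Aqq {N : ℕ} (α : Fin N → ℂ) (z : Phase N) : ℂ := ∑ j, α j * z.2 j * z.2 j

/-- `F₁ = -⟨A q, q⟩ - ⟨p, q⟩²`. -/
def F1 {N : ℕ} (α : Fin N → ℂ) (z : Phase N) : ℂ := -Aqq α z - (∑ j, z.1 j * z.2 j) ^ 2

/-- `α(ζ) = ∏ⱼ (ζ - αⱼ²)`. -/
def alphaFun {N : ℕ} (α : Fin N → ℂ) (ζ : ℂ) : ℂ := ∏ j, (ζ - α j ^ 2)

/-- `R(ζ) = ζ α(ζ) Z(ζ)` with `Z(ζ) = ∏ₖ (ζ - ζₖ)`. -/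
def curvePoly {g : ℕ} (α : Fin (g + 1) → ℂ) (zk : Fin g → ℂ) : ℂ[X] :=
  X * (∏ j, (X - C (α j ^ 2))) * ∏ k, (X - C (zk k))

/-- The branch point `𝔬 = (ζ = 0, ξ = 0)`. -/
def origin {g : ℕ} (α : Fin (g + 1) → ℂ) (zk : Fin g → ℂ) : Pt (curvePoly α zk) :=
  .affine 0 0 (by simp [curvePoly])

/-- `b = f_γ(p, q) = (-γ Q_γ(p, q) ± √(-𝓕_γ(p, q))) / Q_γ(A q, q)`, with the sign `ε = ±1`. -/
def fGamma {N : ℕ} (α : Fin N → ℂ) (γ ε : ℂ) (z : Phase N) : ℂ :=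
  (-γ * Q α γ z.1 z.2 + ε * (-genF α γ z) ^ (1 / 2 : ℂ)) / Q α γ (α * z.2) z.2

/-- The Darboux matrix `D^{(γ)}(λ, b)`. -/
def darboux (γ lam b : ℂ) : Matrix (Fin 2) (Fin 2) ℂ :=
  !![lam, γ * b; γ * b⁻¹, lam]

/-- The map `S_γ : (p, q) ↦ (p̃, q̃)`. -/
def S {N : ℕ} (α : Fin N → ℂ) (γ ε : ℂ) (z : Phase N) : Phase N :=
  (fun j => (α j ^ 2 - γ ^ 2) ^ (-(1 / 2) : ℂ) * (α j * z.1 j + γ * fGamma α γ ε z * z.2 j),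
   fun j => (α j ^ 2 - γ ^ 2) ^ (-(1 / 2) : ℂ) * (γ * (fGamma α γ ε z)⁻¹ * z.1 j + α j * z.2 j))

/-- The discrete flow `(p(m), q(m)) = S_γ^m (p₀, q₀)`. -/
def flow {N : ℕ} (α : Fin N → ℂ) (γ ε : ℂ) (z₀ : Phase N) (m : ℕ) : Phase N :=
  (S α γ ε)^[m] z₀

/-- `b_m = f_γ(p(m), q(m))`. -/
def bSeq {N : ℕ} (α : Fin N → ℂ) (γ ε : ℂ) (z₀ : Phase N) (m : ℕ) : ℂ :=
  fGamma α γ ε (flow α γ ε z₀ m)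

/-- The first `m` iterates of `S_γ` are defined: at each step the denominator of `f_γ` and the value
`b_i` (which is inverted) do not vanish. -/
def FlowDefined {N : ℕ} (α : Fin N → ℂ) (γ ε : ℂ) (z₀ : Phase N) (m : ℕ) : Prop :=
  ∀ i < m, Q α γ (α * (flow α γ ε z₀ i).2) (flow α γ ε z₀ i).2 ≠ 0 ∧ bSeq α γ ε z₀ i ≠ 0

/-- The fundamental matrix: `M(0, λ) = I`, `M(m + 1, λ) = D^{(γ)}(λ, b_m) M(m, λ)`. -/
def fundM {N : ℕ} (α : Fin N → ℂ) (γ ε : ℂ) (z₀ : Phase N) (lam : ℂ) :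
    ℕ → Matrix (Fin 2) (Fin 2) ℂ
  | 0 => 1
  | m + 1 => darboux γ lam (bSeq α γ ε z₀ m) * fundM α γ ε z₀ lam m

/-! ### The Baker functions -/

/-- `ρ_λ = √(-F₁) ξ / (λ α(λ²))`, the eigenvalue of `L(λ; p₀, q₀)` attached to the point `(λ², ξ)`;
`κ` is the chosen `√(-F₁)`. -/
def rho {N : ℕ} (α : Fin N → ℂ) (κ lam ξ : ℂ) : ℂ := κ * ξ / (lam * alphaFun α (lam ^ 2))

/-- `c_λ^± = (L₀¹¹(λ) ± ρ) / L₀²¹(λ)`, with the sign passed as `s = ±1`. -/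
def cEig {N : ℕ} (α : Fin N → ℂ) (z₀ : Phase N) (s : ℤˣ) (lam r : ℂ) : ℂ :=
  (L α lam z₀ 0 0 + ((s : ℤ) : ℂ) * r) / L α lam z₀ 1 0

/-- `h_±(m, λ) = M(m, λ) (c_λ^±, 1)ᵀ`, where `±ρ` are the eigenvalues of `L₀(λ)`. -/
def hEig {N : ℕ} (α : Fin N → ℂ) (γ ε : ℂ) (z₀ : Phase N) (s : ℤˣ) (m : ℕ) (lam r : ℂ) :
    Fin 2 → ℂ :=
  (fundM α γ ε z₀ lam m).mulVec ![cEig α z₀ s lam r, 1]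

/-- The Baker function `H^{(2)}(m, ·)`: at `(λ², ξ)` it is `h_+^{(2)}(m, λ)` for even `m` and
`λ h_+^{(2)}(m, λ)` for odd `m`, evaluated here with the principal `λ = ζ^{1/2}`.  The values at the
points at infinity (and at other isolated points where the formula degenerates) are immaterial. -/
def baker {g : ℕ} (α : Fin (g + 1) → ℂ) (γ ε κ : ℂ) (z₀ : Phase (g + 1)) (zk : Fin g → ℂ) (m : ℕ) :
    Pt (curvePoly α zk) → ℂ
  | .affine ζ ξ _ =>
      (if Even m then 1 else ζ ^ (1 / 2 : ℂ)) *
        hEig α γ ε z₀ 1 m (ζ ^ (1 / 2 : ℂ)) (rho α κ (ζ ^ (1 / 2 : ℂ)) ξ) 1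
  | .infty _ => 0

/-! ### The points occurring in the divisors -/

/-- `ν₁², …, ν_g²` are the roots of `L²¹`:
`L²¹(λ) = ⟨A q, q⟩ ∏ⱼ (λ² - νⱼ²) / α(λ²)`, with multiplicities. -/
def IsElliptic {g : ℕ} (α : Fin (g + 1) → ℂ) (z : Phase (g + 1)) (nu2 : Fin g → ℂ) : Prop :=
  ∀ lam : ℂ, (∀ j, lam ^ 2 ≠ α j ^ 2) →
    L α lam z 1 0 = Aqq α z * (∏ j, (lam ^ 2 - nu2 j)) / alphaFun α (lam ^ 2)

/-- The `ξ`-coordinate of `𝔭(ν²)` for a root `ν²` of `L²¹(·; p, q)`, determined by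
`L¹¹(ν) = √(-F₁) ξ / (ν α(ν²))`, that is `√(-F₁) ξ = ν² α(ν²) Q_ν(p, q)`.
(If `ν² = αⱼ²` this is `0`, the only possible value on the curve.) -/
def xiNu {N : ℕ} (α : Fin N → ℂ) (κ : ℂ) (z : Phase N) (nu2 : ℂ) : ℂ :=
  nu2 * alphaFun α nu2 * (∑ j, z.1 j * z.2 j / (nu2 - α j ^ 2)) / κ

/-- The `ξ`-coordinate of `𝔭(γ²)`: of the two points over `γ²` it is the one with
`ρ_γ = -ε √(-𝓕_γ)`, i.e. the one with `b = (-γ Q_γ(p, q) - ρ_γ) / Q_γ(A q, q)`, equivalently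
`c_γ^+ = -b₀`. -/
def xiGamma {N : ℕ} (α : Fin N → ℂ) (γ ε κ : ℂ) (z₀ : Phase N) : ℂ :=
  -(γ * alphaFun α (γ ^ 2) * (ε * (-genF α γ z₀) ^ (1 / 2 : ℂ))) / κ

end LSKdV

end

noncomputable section

namespace LSKdV

/-! ### The Darboux intertwining relation. -/

section Lax

variable {N : ℕ} {α : Fin N → ℂ} {γ ε : ℂ} {z : Phase N}

/-! The number `b` is chosen so that the kernel vector `(-b, 1)` of the Darboux matrix at `λ = γ` is
an eigenvector of `L(γ)`. This gives the intertwining `L(λ; S z) D = D L(λ; z)` (`L_S_mul_darboux`).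
Iterating, `L_m M = M L_0`, so `det L` is constant along the flow and `h_±` are eigenvectors of
`L_m` with the eigenvalues `±ρ` of `L_0`.

Write `u_i` and `a_i` for the numerators of `L_i²¹` and of `L_i¹¹ / λ` over `α(ζ)`, and `σ` for the
hyperelliptic involution. Two consequences carry the proof. The norm is explicit: `h₊⁽²⁾ h₋⁽²⁾ = (ζ
- γ²)^m u_m / u_0` (`hEig_mul_hEig_neg`), since `det M = (ζ - γ²)^m`. The direction is explicit as
well: `h₊` is proportional to `((ζ a_m + κ ξ) / λ, u_m)` (`hEig_mul_lower`).

The norm only shows the sum of the orders at `P` and `σP`. To separate the two points it is enough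
to bound the order of the Baker function from below by the claimed divisor at every point: since
these bounds add up to the order of the norm, each is an equality (`hasDivisor_of_norm`).

The lower bounds are local. At affine points the recursion creates no poles beyond those of `c⁺`,
which lie at the `𝔭(ν²(0))` (`ordGE_hEig`). At `𝔭(γ²)` each Darboux step adds a zero, because
`(-b_i, 1)` is killed (`ordGE_hEig_gamma`). The zeros at `𝔭(ν²(m))` come from the proportionality,
by comparing `u_m` with `ζ a_m + κ ξ` (`AffineChart.eigen_ord`). At infinity a recursion over pairs
of steps gives one pole per pair (`ordGE_baker_infty`). -/

lemma cpow_neg_half_sq (w : ℂ) : (w ^ (-(1 / 2) : ℂ)) ^ 2 = w⁻¹ := by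
  rw [Complex.cpow_neg, inv_pow, sq_cpow_half]

lemma genF_eq (lam : ℂ) (z : Phase N) :
    genF α lam z = -(lam * Q α lam z.1 z.2) ^ 2
      - (1 - Q α lam (α * z.1) z.1) * Q α lam (α * z.2) z.2 := by
  simp only [genF, L, Matrix.det_fin_two_of]
  ring

lemma fGamma_mul (hU : Q α γ (α * z.2) z.2 ≠ 0) :
    fGamma α γ ε z * Q α γ (α * z.2) z.2 =
      -γ * Q α γ z.1 z.2 + ε * (-genF α γ z) ^ (1 / 2 : ℂ) := by
  rw [fGamma, div_mul_cancel₀ _ hU]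

/-- Completing the square in the definition of `b` gives `(Q_γ(Aq,q) b + γ Q_γ(p,q))² = -𝓕_γ`. The
resulting quadratic says that `(-b, 1)`, the kernel of the Darboux matrix at `λ = γ`, is an
eigenvector of `L(γ)`; it is the only property of `b`, besides `b ≠ 0`, used for the intertwining.
-/
lemma fGamma_quadratic (hε : ε = 1 ∨ ε = -1) (hU : Q α γ (α * z.2) z.2 ≠ 0) :
    Q α γ (α * z.2) z.2 * fGamma α γ ε z ^ 2 + 2 * γ * Q α γ z.1 z.2 * fGamma α γ ε z =
      1 - Q α γ (α * z.1) z.1 := by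
  have h1 := fGamma_mul (ε := ε) hU
  have h2 := sq_cpow_half (-genF α γ z)
  have hε2 : ε ^ 2 = 1 := by rcases hε with rfl | rfl <;> norm_num
  rw [genF_eq] at h2
  apply mul_left_cancel₀ hU
  rw [genF_eq] at h1
  set s := (-(-(γ * Q α γ z.1 z.2) ^ 2
      - (1 - Q α γ (α * z.1) z.1) * Q α γ (α * z.2) z.2)) ^ (1 / 2 : ℂ)
  linear_combination (fGamma α γ ε z * Q α γ (α * z.2) z.2 + γ * Q α γ z.1 z.2
    + ε * s) * h1 + ε ^ 2 * h2 +
      ((γ * Q α γ z.1 z.2) ^ 2 + (1 - Q α γ (α * z.1) z.1) * Q α γ (α * z.2) z.2) * hε2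

/-- The Darboux transformation intertwines the Lax matrices of `z` and `S_γ z`. -/
theorem L_S_mul_darboux (hγ : ∀ j, γ ^ 2 ≠ α j ^ 2) (hε : ε = 1 ∨ ε = -1)
    (hU : Q α γ (α * z.2) z.2 ≠ 0) (hb : fGamma α γ ε z ≠ 0)
    {lam : ℂ} (hl : ∀ j, lam ^ 2 ≠ α j ^ 2) :
    L α lam (S α γ ε z) * darboux γ lam (fGamma α γ ε z) =
      darboux γ lam (fGamma α γ ε z) * L α lam z := by
  have hq := fGamma_quadratic hε hU
  set b := fGamma α γ ε z with hbdef
  set s : Fin N → ℂ := fun j => (α j ^ 2 - γ ^ 2) ^ (-(1 / 2) : ℂ) with hs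
  -- Only the square of the normalising factor enters, as `L` is quadratic in `(p, q)`; the branch
  -- of the root is irrelevant.
  have hs2 : ∀ j, s j ^ 2 * (α j ^ 2 - γ ^ 2) = 1 := fun j => by
    rw [hs]; dsimp only
    rw [cpow_neg_half_sq, inv_mul_cancel₀ (sub_ne_zero.mpr (hγ j).symm)]
  have hd : ∀ j, (lam ^ 2 - α j ^ 2) ≠ 0 := fun j => sub_ne_zero.mpr (hl j)
  have hdγ : ∀ j, (γ ^ 2 - α j ^ 2) ≠ 0 := fun j => sub_ne_zero.mpr (hγ j)
  have hS1 : ∀ j, (S α γ ε z).1 j = s j * (α j * z.1 j + γ * b * z.2 j) := fun j => rfl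
  have hS2 : ∀ j, (S α γ ε z).2 j = s j * (γ * b⁻¹ * z.1 j + α j * z.2 j) := fun j => rfl
  have hbb : b * b⁻¹ = 1 := mul_inv_cancel₀ hb
  -- The change of `⟨p, q⟩` is the part of the identity not seen by the residues in `λ²`. It is the
  -- one place where the quadratic equation for `b` is used.
  have key : ∑ j, (S α γ ε z).1 j * (S α γ ε z).2 j = ∑ j, z.1 j * z.2 j - γ * b⁻¹ := by
    have : ∀ j, (S α γ ε z).1 j * (S α γ ε z).2 j - z.1 j * z.2 j =
        -(γ * b⁻¹) * ((α * z.1) j * z.1 j / (γ ^ 2 - α j ^ 2))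
          - 2 * γ ^ 2 * (z.1 j * z.2 j / (γ ^ 2 - α j ^ 2))
          - γ * b * ((α * z.2) j * z.2 j / (γ ^ 2 - α j ^ 2)) := fun j => by
      rw [hS1, hS2]
      simp only [Pi.mul_apply]
      have h1 := hs2 j
      have h2 := hdγ j
      have : s j ^ 2 = - (γ ^ 2 - α j ^ 2)⁻¹ := by
        field_simp
        linear_combination -h1
      have h3 : (γ ^ 2 - α j ^ 2) * (γ ^ 2 - α j ^ 2)⁻¹ = 1 := mul_inv_cancel₀ h2
      simp only [div_eq_mul_inv]
      set d := (γ ^ 2 - α j ^ 2)⁻¹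
      linear_combination (α j * z.1 j + γ * b * z.2 j) * (γ * b⁻¹ * z.1 j + α j * z.2 j) * this
         - d * γ ^ 2 * z.1 j * z.2 j * hbb + z.1 j * z.2 j * h3
    have h2 : ∑ j, ((S α γ ε z).1 j * (S α γ ε z).2 j - z.1 j * z.2 j) = -(γ * b⁻¹) := by
      rw [Finset.sum_congr rfl fun j _ => this j, Finset.sum_sub_distrib, Finset.sum_sub_distrib,
        ← Finset.mul_sum, ← Finset.mul_sum, ← Finset.mul_sum]
      change -(γ * b⁻¹) * Q α γ (α * z.1) z.1 - 2 * γ ^ 2 * Q α γ z.1 z.2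
        - γ * b * Q α γ (α * z.2) z.2 = _
      linear_combination (-γ * b⁻¹) * hq + (γ * b * Q α γ (α * z.2) z.2 +
        2 * γ ^ 2 * Q α γ z.1 z.2) * hbb
    rw [Finset.sum_sub_distrib] at h2
    linear_combination h2
  -- This rewrites `⟨p, q⟩` as `λ² Q_λ(p, q)` minus a sum of partial fractions, so that `key`
  -- supplies the diagonal entries.
  have hsum : ∀ f : Fin N → ℂ, ∑ j, f j =
      lam ^ 2 * ∑ j, f j / (lam ^ 2 - α j ^ 2) - ∑ j, α j ^ 2 * f j / (lam ^ 2 - α j ^ 2) := by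
    intro f
    rw [Finset.mul_sum, ← Finset.sum_sub_distrib]
    refine Finset.sum_congr rfl fun j _ => ?_
    have := hd j
    field_simp
  rw [hsum, hsum (fun j => z.1 j * z.2 j)] at key
  -- the residues at `λ² = αⱼ²`
  have e00 : ∑ j, α j ^ 2 * ((S α γ ε z).1 j * (S α γ ε z).2 j) / (lam ^ 2 - α j ^ 2) -
      γ * b⁻¹ * Q α lam (α * (S α γ ε z).1) (S α γ ε z).1 =
      ∑ j, α j ^ 2 * (z.1 j * z.2 j) / (lam ^ 2 - α j ^ 2) +
        γ * b * Q α lam (α * z.2) z.2 := by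
    simp only [Q, Finset.mul_sum, ← Finset.sum_sub_distrib, ← Finset.sum_add_distrib]
    refine Finset.sum_congr rfl fun j _ => ?_
    rw [hS1, hS2]
    simp only [Pi.mul_apply, hS1, div_eq_mul_inv]
    linear_combination (lam ^ 2 - α j ^ 2)⁻¹ * α j * (α j * z.1 j + γ * b * z.2 j) * z.2 j * hs2 j
      + (-(lam ^ 2 - α j ^ 2)⁻¹ * α j * s j ^ 2 * γ ^ 2 * (α j * z.1 j + γ * b * z.2 j) * z.2 j)
        * hbb
  have e01 : lam * γ * b * Q α lam (S α γ ε z).1 (S α γ ε z).2 -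
      lam * Q α lam (α * (S α γ ε z).1) (S α γ ε z).1 =
      -lam * Q α lam (α * z.1) z.1 - γ * b * lam * Q α lam z.1 z.2 := by
    simp only [Q, Finset.mul_sum, ← Finset.sum_sub_distrib]
    refine Finset.sum_congr rfl fun j _ => ?_
    simp only [Pi.mul_apply, hS1, hS2, div_eq_mul_inv]
    linear_combination -(lam ^ 2 - α j ^ 2)⁻¹ * lam * (α j * z.1 j + γ * b * z.2 j) * z.1 j * hs2 j
      + ((lam ^ 2 - α j ^ 2)⁻¹ * lam * s j ^ 2 * γ ^ 2 * (α j * z.1 j + γ * b * z.2 j) * z.1 j)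
        * hbb
  have e10 : lam * Q α lam (α * (S α γ ε z).2) (S α γ ε z).2 -
      γ * b⁻¹ * lam * Q α lam (S α γ ε z).1 (S α γ ε z).2 =
      γ * b⁻¹ * lam * Q α lam z.1 z.2 + lam * Q α lam (α * z.2) z.2 := by
    simp only [Q, Finset.mul_sum, ← Finset.sum_sub_distrib, ← Finset.sum_add_distrib]
    refine Finset.sum_congr rfl fun j _ => ?_
    simp only [Pi.mul_apply, hS1, hS2, div_eq_mul_inv]
    linear_combination (lam ^ 2 - α j ^ 2)⁻¹ * lam * (γ * b⁻¹ * z.1 j + α j * z.2 j) * z.2 j * hs2 j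
      + (-(lam ^ 2 - α j ^ 2)⁻¹ * lam * s j ^ 2 * γ ^ 2 * (γ * b⁻¹ * z.1 j + α j * z.2 j) * z.2 j)
        * hbb
  have e11 : γ * b * Q α lam (α * (S α γ ε z).2) (S α γ ε z).2 -
      ∑ j, α j ^ 2 * ((S α γ ε z).1 j * (S α γ ε z).2 j) / (lam ^ 2 - α j ^ 2) =
      -(γ * b⁻¹) * Q α lam (α * z.1) z.1 -
      ∑ j, α j ^ 2 * (z.1 j * z.2 j) / (lam ^ 2 - α j ^ 2) := by
    simp only [Q, Finset.mul_sum, ← Finset.sum_sub_distrib]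
    refine Finset.sum_congr rfl fun j _ => ?_
    simp only [Pi.mul_apply, hS1, hS2, div_eq_mul_inv]
    linear_combination -(lam ^ 2 - α j ^ 2)⁻¹ * α j * (γ * b⁻¹ * z.1 j + α j * z.2 j) * z.1 j * hs2 j
      + ((lam ^ 2 - α j ^ 2)⁻¹ * α j * s j ^ 2 * γ ^ 2 * (γ * b⁻¹ * z.1 j + α j * z.2 j) * z.1 j)
        * hbb
  change lam ^ 2 * Q α lam (S α γ ε z).1 (S α γ ε z).2 - _ =
    lam ^ 2 * Q α lam z.1 z.2 - _ - γ * b⁻¹ at key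
  ext i j
  fin_cases i <;> fin_cases j <;>
    simp only [L, darboux, Matrix.mul_apply, Fin.sum_univ_two, Matrix.of_apply, Matrix.cons_val',
      Matrix.cons_val_zero, Matrix.cons_val_one, Fin.zero_eta, Fin.mk_one, Fin.isValue,
      Matrix.cons_val_fin_one]
  · linear_combination key + e00
  · linear_combination e01
  · linear_combination e10
  · linear_combination e11 - key

end Lax

/-! ### Numerators of the Lax entries as polynomials in `ζ`. -/

section Polynomials

variable {N : ℕ} (α : Fin N → ℂ)

/-- `α(ζ)` as a polynomial. -/
def alphaPoly : ℂ[X] := ∏ j, (X - C (α j ^ 2))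

/-- The numerator of `∑ⱼ cⱼ / (ζ - αⱼ²)` over the denominator `α(ζ)`. -/
def numer (c : Fin N → ℂ) : ℂ[X] :=
  ∑ j, C (c j) * ∏ k ∈ Finset.univ.erase j, (X - C (α k ^ 2))

/-- The polynomial `a` with `L¹¹(λ) = λ a(λ²) / α(λ²)`. -/
def diagPoly (z : Phase N) : ℂ[X] := numer α (z.1 * z.2)

/-- The numerator of `L²¹`. -/
def lowerPoly (z : Phase N) : ℂ[X] := numer α (α * z.2 * z.2)

/-- The numerator of `L¹²`. -/
def upperPoly (z : Phase N) : ℂ[X] := alphaPoly α - numer α (α * z.1 * z.1)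

/-- The numerator of `-det L` over `α²`. -/
def normPoly (z : Phase N) : ℂ[X] := X * diagPoly α z ^ 2 + upperPoly α z * lowerPoly α z

variable {α}

@[simp] lemma alphaPoly_eval (ζ : ℂ) : (alphaPoly α).eval ζ = alphaFun α ζ := by
  simp [alphaPoly, alphaFun, eval_prod]

lemma alphaFun_ne_zero {ζ : ℂ} (h : ∀ j, ζ ≠ α j ^ 2) : alphaFun α ζ ≠ 0 :=
  Finset.prod_ne_zero_iff.mpr fun j _ => sub_ne_zero.mpr (h j)

lemma ne_of_alphaFun_ne_zero {ζ : ℂ} (h : alphaFun α ζ ≠ 0) (j : Fin N) : ζ ≠ α j ^ 2 :=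
  sub_ne_zero.mp (Finset.prod_ne_zero_iff.mp h j (Finset.mem_univ j))

lemma alphaFun_eq_zero (j : Fin N) : alphaFun α (α j ^ 2) = 0 :=
  Finset.prod_eq_zero (Finset.mem_univ j) (sub_self _)

lemma numer_eval (c : Fin N → ℂ) {ζ : ℂ} (h : alphaFun α ζ ≠ 0) :
    (numer α c).eval ζ = alphaFun α ζ * ∑ j, c j / (ζ - α j ^ 2) := by
  rw [numer, eval_finsetSum, Finset.mul_sum]
  refine Finset.sum_congr rfl fun j _ => ?_
  have hj := sub_ne_zero.mpr (ne_of_alphaFun_ne_zero h j)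
  rw [alphaFun, ← Finset.mul_prod_erase _ _ (Finset.mem_univ j)]
  simp only [eval_mul, eval_C, eval_prod, eval_sub, eval_X]
  field_simp

lemma numer_eval_pole (c : Fin N → ℂ) (i : Fin N) :
    (numer α c).eval (α i ^ 2) = c i * ∏ k ∈ Finset.univ.erase i, (α i ^ 2 - α k ^ 2) := by
  rw [numer, eval_finsetSum, Finset.sum_eq_single i]
  · simp [eval_prod]
  · intro j _ hj
    rw [eval_mul, eval_prod, Finset.prod_eq_zero (i := i), mul_zero]
    · exact Finset.mem_erase.mpr ⟨hj.symm, Finset.mem_univ _⟩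
    · simp
  · simp

lemma natDegree_numer_le (c : Fin N → ℂ) : (numer α c).natDegree ≤ N - 1 := by
  refine natDegree_sum_le_of_forall_le _ _ fun j _ => ?_
  refine (natDegree_C_mul_le _ _).trans ((natDegree_prod_le _ _).trans ?_)
  refine (Finset.sum_le_card_nsmul _ _ 1 fun k _ => (natDegree_X_sub_C_le _)).trans ?_
  simp

lemma alphaPoly_monic : (alphaPoly α).Monic := monic_prod_of_monic _ _ fun _ _ => monic_X_sub_C _

lemma L00_mul {lam : ℂ} (z : Phase N) (h : alphaFun α (lam ^ 2) ≠ 0) :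
    L α lam z 0 0 * alphaFun α (lam ^ 2) = lam * (diagPoly α z).eval (lam ^ 2) := by
  rw [diagPoly, numer_eval _ h]
  simp [L, Q]
  ring

lemma L10_mul {lam : ℂ} (z : Phase N) (h : alphaFun α (lam ^ 2) ≠ 0) :
    L α lam z 1 0 * alphaFun α (lam ^ 2) = (lowerPoly α z).eval (lam ^ 2) := by
  rw [lowerPoly, numer_eval _ h]
  simp [L, Q]
  ring

lemma L01_mul {lam : ℂ} (z : Phase N) (h : alphaFun α (lam ^ 2) ≠ 0) :
    L α lam z 0 1 * alphaFun α (lam ^ 2) = (upperPoly α z).eval (lam ^ 2) := by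
  rw [upperPoly, eval_sub, alphaPoly_eval, numer_eval _ h]
  simp [L, Q]
  ring

lemma L11_eq (lam : ℂ) (z : Phase N) : L α lam z 1 1 = -L α lam z 0 0 := by simp [L]

lemma normPoly_eval {lam : ℂ} (z : Phase N) (h : alphaFun α (lam ^ 2) ≠ 0) :
    (normPoly α z).eval (lam ^ 2) = -genF α lam z * alphaFun α (lam ^ 2) ^ 2 := by
  simp only [normPoly, eval_add, eval_mul, eval_pow, eval_X]
  rw [← L10_mul z h, ← L01_mul z h, genF, Matrix.det_fin_two, L11_eq]
  linear_combination -(lam * (diagPoly α z).eval (lam ^ 2) +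
    L α lam z 0 0 * alphaFun α (lam ^ 2)) * L00_mul z h

/-- Polynomials that agree at all squares outside the zero set of a nonzero polynomial are equal. -/
lemma poly_eq_of_eval_sq {p q r : ℂ[X]} (hr : r ≠ 0)
    (h : ∀ lam : ℂ, r.eval (lam ^ 2) ≠ 0 → p.eval (lam ^ 2) = q.eval (lam ^ 2)) : p = q := by
  have h0 : r * (p - q) = 0 := by
    refine funext fun ζ => ?_
    by_cases hz : r.eval ζ = 0
    · simp [hz]
    · have := h (ζ ^ (1 / 2 : ℂ)) (by rwa [sq_cpow_half])
      rw [sq_cpow_half] at this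
      simp [this]
  exact sub_eq_zero.mp ((mul_eq_zero.mp h0).resolve_left hr)

/-- Clearing denominators extends the factorisation across the excluded values `ζ = αⱼ²`, which may
themselves be among the roots. -/
lemma IsElliptic.lowerPoly_eq {g : ℕ} {α : Fin (g + 1) → ℂ} {z : Phase (g + 1)} {nu : Fin g → ℂ}
    (h : IsElliptic α z nu) : lowerPoly α z = C (Aqq α z) * ∏ j, (X - C (nu j)) := by
  refine poly_eq_of_eval_sq (alphaPoly_monic (α := α)).ne_zero fun lam hl => ?_
  rw [alphaPoly_eval] at hl
  rw [← L10_mul z hl, h lam (ne_of_alphaFun_ne_zero hl), div_mul_cancel₀ _ hl]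
  simp [eval_prod]

/-- A common zero of `L²¹` and `α` is a zero of `L¹¹`. -/
lemma diagPoly_eval_pole (hα0 : ∀ j, α j ≠ 0) (hα : Function.Injective fun j => α j ^ 2)
    {z : Phase N} {i : Fin N} (h : (lowerPoly α z).eval (α i ^ 2) = 0) :
    (diagPoly α z).eval (α i ^ 2) = 0 := by
  rw [lowerPoly, numer_eval_pole] at h
  rw [diagPoly, numer_eval_pole]
  have hp : ∏ k ∈ Finset.univ.erase i, (α i ^ 2 - α k ^ 2) ≠ 0 :=
    Finset.prod_ne_zero_iff.mpr fun k hk => sub_ne_zero.mpr fun e =>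
      (Finset.mem_erase.mp hk).1 (hα e).symm
  have hq : z.2 i = 0 := by simpa [hp, hα0 i] using h
  simp [hq]

end Polynomials

/-! ### Iterated intertwining, eigenvectors and their norm. -/

section Flow

variable {N : ℕ} {α : Fin N → ℂ} {γ ε : ℂ} {z₀ : Phase N} {m : ℕ}

lemma FlowDefined.mono {i : ℕ} (h : FlowDefined α γ ε z₀ m) (hi : i ≤ m) :
    FlowDefined α γ ε z₀ i := fun k hk => h k (hk.trans_le hi)

lemma flow_succ (i : ℕ) : flow α γ ε z₀ (i + 1) = S α γ ε (flow α γ ε z₀ i) :=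
  Function.iterate_succ_apply' _ _ _

theorem L_flow_mul_fundM (hγ : ∀ j, γ ^ 2 ≠ α j ^ 2) (hε : ε = 1 ∨ ε = -1) {lam : ℂ}
    (hl : ∀ j, lam ^ 2 ≠ α j ^ 2) :
    ∀ {m : ℕ}, FlowDefined α γ ε z₀ m →
    L α lam (flow α γ ε z₀ m) * fundM α γ ε z₀ lam m = fundM α γ ε z₀ lam m * L α lam z₀
  | 0, _ => by simp [fundM, flow]
  | m + 1, h => by
    have h1 := h m m.lt_succ_self
    rw [fundM, flow_succ, ← mul_assoc, bSeq, L_S_mul_darboux hγ hε h1.1 h1.2 hl, mul_assoc,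
      L_flow_mul_fundM hγ hε hl (h.mono m.le_succ), ← mul_assoc]

lemma det_darboux {lam b : ℂ} (hb : b ≠ 0) : (darboux γ lam b).det = lam ^ 2 - γ ^ 2 := by
  rw [darboux, Matrix.det_fin_two_of]
  linear_combination -γ ^ 2 * mul_inv_cancel₀ hb

lemma det_fundM {lam : ℂ} :
    ∀ {m : ℕ}, FlowDefined α γ ε z₀ m →
    (fundM α γ ε z₀ lam m).det = (lam ^ 2 - γ ^ 2) ^ m
  | 0, _ => by simp [fundM]
  | m + 1, h => by
    rw [fundM, Matrix.det_mul, det_darboux (h m m.lt_succ_self).2, det_fundM (h.mono m.le_succ)]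
    exact (pow_succ' _ _).symm

/-- The determinant of the Lax matrix is invariant under the flow. -/
theorem normPoly_flow (hγ : ∀ j, γ ^ 2 ≠ α j ^ 2) (hε : ε = 1 ∨ ε = -1)
    (h : FlowDefined α γ ε z₀ m) : normPoly α (flow α γ ε z₀ m) = normPoly α z₀ := by
  -- The extra factor excludes `λ² = γ²`, where `det M` may vanish and cannot be cancelled.
  refine poly_eq_of_eval_sq (r := alphaPoly α * (X - C (γ ^ 2)))
    (alphaPoly_monic.mul (monic_X_sub_C _)).ne_zero fun lam hl => ?_
  simp only [eval_mul, alphaPoly_eval, eval_sub, eval_X, eval_C] at hl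
  have hl1 := left_ne_zero_of_mul hl
  rw [normPoly_eval _ hl1, normPoly_eval _ hl1]
  have e := congrArg Matrix.det (L_flow_mul_fundM hγ hε (ne_of_alphaFun_ne_zero hl1) h)
  rw [Matrix.det_mul, Matrix.det_mul, det_fundM h, mul_comm] at e
  rw [genF, genF, mul_left_cancel₀ (pow_ne_zero m (right_ne_zero_of_mul hl)) e]

lemma hEig_zero (s : ℤˣ) (lam r : ℂ) : hEig α γ ε z₀ s 0 lam r = ![cEig α z₀ s lam r, 1] := by
  simp [hEig, fundM]

lemma hEig_succ (s : ℤˣ) (lam r : ℂ) (i : ℕ) : hEig α γ ε z₀ s (i + 1) lam r =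
    (darboux γ lam (bSeq α γ ε z₀ i)).mulVec (hEig α γ ε z₀ s i lam r) := by
  rw [hEig, fundM, ← Matrix.mulVec_mulVec, hEig]

lemma hEig_succ_zero (s : ℤˣ) (lam r : ℂ) (i : ℕ) : hEig α γ ε z₀ s (i + 1) lam r 0 =
    lam * hEig α γ ε z₀ s i lam r 0 + γ * bSeq α γ ε z₀ i * hEig α γ ε z₀ s i lam r 1 := by
  rw [hEig_succ]
  simp [darboux, Matrix.mulVec, dotProduct, Fin.sum_univ_two]

lemma hEig_succ_one (s : ℤˣ) (lam r : ℂ) (i : ℕ) : hEig α γ ε z₀ s (i + 1) lam r 1 =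
    γ * (bSeq α γ ε z₀ i)⁻¹ * hEig α γ ε z₀ s i lam r 0 + lam * hEig α γ ε z₀ s i lam r 1 := by
  rw [hEig_succ]
  simp [darboux, Matrix.mulVec, dotProduct, Fin.sum_univ_two]

lemma cEig_neg (s : ℤˣ) (lam r : ℂ) : cEig α z₀ s lam (-r) = cEig α z₀ (-s) lam r := by
  simp [cEig]

lemma hEig_neg (s : ℤˣ) (i : ℕ) (lam r : ℂ) :
    hEig α γ ε z₀ s i lam (-r) = hEig α γ ε z₀ (-s) i lam r := by
  simp only [hEig, cEig_neg]

lemma cEig_neg_lam (s : ℤˣ) (lam r : ℂ) : cEig α z₀ s (-lam) (-r) = -cEig α z₀ s lam r := by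
  simp [cEig, L, Q]
  ring

/-- Behaviour of `h_±` under the change of the root `λ = ζ^{1/2}`. -/
lemma hEig_neg_lam (s : ℤˣ) (lam r : ℂ) : ∀ i : ℕ,
    hEig α γ ε z₀ s i (-lam) (-r) 0 = -(-1) ^ i * hEig α γ ε z₀ s i lam r 0 ∧
    hEig α γ ε z₀ s i (-lam) (-r) 1 = (-1) ^ i * hEig α γ ε z₀ s i lam r 1
  | 0 => by simp [hEig_zero, cEig_neg_lam]
  | i + 1 => by
    obtain ⟨h0, h1⟩ := hEig_neg_lam s lam r i
    rw [hEig_succ_zero, hEig_succ_one, hEig_succ_zero, hEig_succ_one, h0, h1]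
    constructor <;> ring

/-- `h_±(m, λ)` is an eigenvector of `L_m(λ)`; the second row of the eigenvalue equation. -/
theorem L_flow_hEig (hγ : ∀ j, γ ^ 2 ≠ α j ^ 2) (hε : ε = 1 ∨ ε = -1) {lam r : ℂ}
    (hl : ∀ j, lam ^ 2 ≠ α j ^ 2) (h : FlowDefined α γ ε z₀ m) (hu : L α lam z₀ 1 0 ≠ 0)
    (hr : r ^ 2 = -genF α lam z₀) :
    L α lam (flow α γ ε z₀ m) 1 0 * hEig α γ ε z₀ 1 m lam r 0 =
      (L α lam (flow α γ ε z₀ m) 0 0 + r) * hEig α γ ε z₀ 1 m lam r 1 := by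
  have h0 : (L α lam z₀).mulVec ![cEig α z₀ 1 lam r, 1] = r • ![cEig α z₀ 1 lam r, 1] := by
    have hc : L α lam z₀ 1 0 * cEig α z₀ 1 lam r = L α lam z₀ 0 0 + r := by
      rw [cEig, mul_div_cancel₀ _ hu]
      simp
    rw [genF, Matrix.det_fin_two, L11_eq] at hr
    ext i
    fin_cases i <;>
      simp only [Matrix.mulVec, dotProduct, Fin.sum_univ_two, Matrix.cons_val_zero,
        Matrix.cons_val_one, Fin.zero_eta, Fin.mk_one, Pi.smul_apply, smul_eq_mul]
    · apply mul_left_cancel₀ hu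
      linear_combination (L α lam z₀ 0 0 - r) * hc - hr
    · rw [L11_eq]
      linear_combination hc
  have h1 : (L α lam (flow α γ ε z₀ m)).mulVec (hEig α γ ε z₀ 1 m lam r) =
      r • hEig α γ ε z₀ 1 m lam r := by
    rw [hEig, Matrix.mulVec_mulVec, L_flow_mul_fundM hγ hε hl h, ← Matrix.mulVec_mulVec, h0,
      Matrix.mulVec_smul]
  have h2 := congrFun h1 1
  simp only [Matrix.mulVec, dotProduct, Fin.sum_univ_two, Pi.smul_apply, smul_eq_mul] at h2
  rw [L11_eq] at h2
  linear_combination h2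

/-- The product `h₊⁽²⁾ h₋⁽²⁾`. -/
theorem hEig_mul_hEig_neg (hγ : ∀ j, γ ^ 2 ≠ α j ^ 2) (hε : ε = 1 ∨ ε = -1) {lam r : ℂ}
    (hl : ∀ j, lam ^ 2 ≠ α j ^ 2) (h : FlowDefined α γ ε z₀ m) (hu : L α lam z₀ 1 0 ≠ 0)
    (hr : r ^ 2 = -genF α lam z₀) :
    hEig α γ ε z₀ 1 m lam r 1 * hEig α γ ε z₀ (-1) m lam r 1 * L α lam z₀ 1 0 =
      (lam ^ 2 - γ ^ 2) ^ m * L α lam (flow α γ ε z₀ m) 1 0 := by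
  have hc : L α lam z₀ 1 0 * cEig α z₀ 1 lam r = L α lam z₀ 0 0 + r := by
    rw [cEig, mul_div_cancel₀ _ hu]
    simp
  have hc' : L α lam z₀ 1 0 * cEig α z₀ (-1) lam r = L α lam z₀ 0 0 - r := by
    rw [cEig, mul_div_cancel₀ _ hu]
    simp [sub_eq_add_neg]
  have e := L_flow_mul_fundM hγ hε hl h
  have e0 := congrFun (congrFun e 1) 0
  have e1 := congrFun (congrFun e 1) 1
  have hd := det_fundM (lam := lam) h
  rw [genF, Matrix.det_fin_two, L11_eq] at hr
  rw [Matrix.det_fin_two] at hd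
  simp only [Matrix.mul_apply, Fin.sum_univ_two] at e0 e1
  simp only [L11_eq] at e0 e1
  simp only [hEig, Matrix.mulVec, dotProduct, Fin.sum_univ_two, Matrix.cons_val_zero,
    Matrix.cons_val_one]
  set M := fundM α γ ε z₀ lam m
  apply mul_left_cancel₀ hu
  -- After multiplication by `L₀²¹` the factors are `M₁₀ (L₀¹¹ ± ρ) + M₁₁ L₀²¹`. Their product is
  -- free of `ρ` because `ρ² = -det L₀`; the second row of `L_m M = M L_0` and `det M` turn the rest
  -- into `L_m²¹`.
  linear_combination (M 1 0 * (L α lam z₀ 1 0 * cEig α z₀ (-1) lam r) + M 1 1 * L α lam z₀ 1 0)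
      * M 1 0 * hc
    + (M 1 0 * (L α lam z₀ 0 0 + r) + M 1 1 * L α lam z₀ 1 0) * M 1 0 * hc'
    - M 1 0 ^ 2 * hr - L α lam z₀ 1 0 * M 1 1 * e0 + L α lam z₀ 1 0 * M 1 0 * e1
    + L α lam z₀ 1 0 * L α lam (flow α γ ε z₀ m) 1 0 * hd

end Flow

/-! ### Calculus of orders of meromorphic germs at `0`. -/

section Order

open Filter Topology

/-- `f` is meromorphic at `0` and vanishes there at least to the order `n`. -/
def OrdGE (f : ℂ → ℂ) (n : ℤ) : Prop := MeromorphicAt f 0 ∧ (n : WithTop ℤ) ≤ meromorphicOrderAt f 0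

/-- `f` is meromorphic at `0` of order exactly `n`. -/
def HasOrd (f : ℂ → ℂ) (n : ℤ) : Prop := MeromorphicAt f 0 ∧ meromorphicOrderAt f 0 = (n : WithTop ℤ)

variable {f g : ℂ → ℂ} {n k : ℤ}

lemma HasOrd.ordGE (h : HasOrd f n) : OrdGE f n := ⟨h.1, h.2.ge⟩

lemma OrdGE.mono (h : OrdGE f n) (hk : k ≤ n) : OrdGE f k :=
  ⟨h.1, (WithTop.coe_le_coe.mpr hk).trans h.2⟩

lemma HasOrd.of_eq (e : n = k) (h : HasOrd f n) : HasOrd f k := e ▸ h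

lemma OrdGE.congr (h : OrdGE f n) (e : f =ᶠ[𝓝[≠] 0] g) : OrdGE g n :=
  ⟨h.1.congr e, by rw [← meromorphicOrderAt_congr e]; exact h.2⟩

lemma HasOrd.congr (h : HasOrd f n) (e : f =ᶠ[𝓝[≠] 0] g) : HasOrd g n :=
  ⟨h.1.congr e, by rw [← meromorphicOrderAt_congr e]; exact h.2⟩

lemma OrdGE.add (hf : OrdGE f n) (hg : OrdGE g n) : OrdGE (fun t => f t + g t) n :=
  ⟨hf.1.add hg.1, (le_min hf.2 hg.2).trans (meromorphicOrderAt_add hf.1 hg.1)⟩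

lemma OrdGE.mul (hf : OrdGE f n) (hg : OrdGE g k) : OrdGE (fun t => f t * g t) (n + k) :=
  ⟨hf.1.mul hg.1, by
    rw [fun_meromorphicOrderAt_mul hf.1 hg.1, WithTop.coe_add]; exact add_le_add hf.2 hg.2⟩

lemma HasOrd.mul (hf : HasOrd f n) (hg : HasOrd g k) : HasOrd (fun t => f t * g t) (n + k) :=
  ⟨hf.1.mul hg.1, by rw [fun_meromorphicOrderAt_mul hf.1 hg.1, WithTop.coe_add, hf.2, hg.2]⟩

lemma HasOrd.inv (hf : HasOrd f n) : HasOrd (fun t => (f t)⁻¹) (-n) :=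
  ⟨hf.1.inv, by rw [fun_meromorphicOrderAt_inv, hf.2]; rfl⟩

lemma HasOrd.pow (hf : HasOrd f n) : ∀ m : ℕ, HasOrd (fun t => f t ^ m) (m * n)
  | 0 => ⟨by simp [MeromorphicAt.const], by
      simp [meromorphicOrderAt_const]⟩
  | m + 1 => by
    have := (hf.pow m).mul hf
    simp only [pow_succ]
    convert this using 1
    push_cast
    ring

lemma HasOrd.prod {ι : Type*} (s : Finset ι) {f : ι → ℂ → ℂ} {n : ι → ℤ}
    (h : ∀ i ∈ s, HasOrd (f i) (n i)) : HasOrd (fun t => ∏ i ∈ s, f i t) (∑ i ∈ s, n i) := by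
  classical
  induction s using Finset.induction_on with
  | empty => simpa using (show HasOrd (fun _ => (1 : ℂ)) 0 from
      ⟨MeromorphicAt.const _ _, by simp [meromorphicOrderAt_const]⟩)
  | insert a s ha ih =>
    simp only [Finset.prod_insert ha, Finset.sum_insert ha]
    exact (h a (Finset.mem_insert_self _ _)).mul
      (ih fun i hi => h i (Finset.mem_insert_of_mem hi))

lemma ordGE_of_analyticAt (hf : AnalyticAt ℂ f 0) : OrdGE f 0 :=
  ⟨hf.meromorphicAt, hf.meromorphicOrderAt_nonneg⟩

lemma hasOrd_of_analyticAt (hf : AnalyticAt ℂ f 0) (h : f 0 ≠ 0) : HasOrd f 0 :=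
  ⟨hf.meromorphicAt, by
    rw [hf.meromorphicOrderAt_eq, hf.analyticOrderAt_eq_zero.mpr h]; rfl⟩

lemma hasOrd_const {c : ℂ} (hc : c ≠ 0) : HasOrd (fun _ => c) 0 :=
  hasOrd_of_analyticAt analyticAt_const hc

lemma ordGE_const (c : ℂ) : OrdGE (fun _ => c) 0 := ordGE_of_analyticAt analyticAt_const

lemma OrdGE.const_mul (c : ℂ) (hf : OrdGE f n) : OrdGE (fun t => c * f t) n := by
  simpa using (ordGE_const c).mul hf

lemma HasOrd.const_mul {c : ℂ} (hc : c ≠ 0) (hf : HasOrd f n) : HasOrd (fun t => c * f t) n := by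
  simpa using (hasOrd_const hc).mul hf

lemma ordGE_one_of_analyticAt (hf : AnalyticAt ℂ f 0) (h : f 0 = 0) : OrdGE f 1 := by
  refine ⟨hf.meromorphicAt, ?_⟩
  have h1 : analyticOrderAt f 0 ≠ 0 := hf.analyticOrderAt_ne_zero.mpr h
  rw [hf.meromorphicOrderAt_eq]
  cases h2 : analyticOrderAt f 0 with
  | top => simp
  | coe k =>
    rw [h2] at h1
    have hk : 1 ≤ k := Nat.one_le_iff_ne_zero.mpr (by exact_mod_cast h1)
    change ((1 : ℤ) : WithTop ℤ) ≤ ((k : ℤ) : WithTop ℤ)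
    exact_mod_cast hk

lemma hasOrd_id : HasOrd (fun t => t) 1 := ⟨MeromorphicAt.id 0, meromorphicOrderAt_id⟩

lemma HasOrd.add_of_ordGE (hf : HasOrd f n) (hg : OrdGE g k) (h : n < k) :
    HasOrd (fun t => f t + g t) n := by
  refine ⟨hf.1.add hg.1, ?_⟩
  have hlt : meromorphicOrderAt f 0 < meromorphicOrderAt g 0 := by
    rw [hf.2]; exact (WithTop.coe_lt_coe.mpr h).trans_le hg.2
  exact (meromorphicOrderAt_add_eq_left_of_lt hg.1 hlt).trans hf.2

lemma HasOrd.unique (hf : HasOrd f n) (hg : HasOrd f k) : n = k := by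
  exact_mod_cast hf.2.symm.trans hg.2

lemma HasOrd.le_of_ordGE (hf : HasOrd f n) (hg : OrdGE f k) : k ≤ n := by
  have := hg.2
  rw [hf.2] at this
  exact_mod_cast this

lemma HasOrd.eventually_ne (hf : HasOrd f n) : ∀ᶠ t in 𝓝[≠] 0, f t ≠ 0 :=
  (meromorphicOrderAt_ne_top_iff_eventually_ne_zero hf.1).mp (by rw [hf.2]; exact WithTop.coe_ne_top)

/-- Division by a function of known order. -/
lemma OrdGE.of_mul {h : ℂ → ℂ} (hh : OrdGE h n) (hg : HasOrd g k)
    (e : (fun t => f t * g t) =ᶠ[𝓝[≠] 0] h) : OrdGE f (n - k) := by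
  refine (hh.mul hg.inv.ordGE).congr ?_
  filter_upwards [e, hg.eventually_ne] with t ht hne
  rw [← ht, mul_inv_cancel_right₀ hne]

/-- Lower bounds for the orders of two factors that add up to the order of the product are sharp. -/
lemma OrdGE.hasOrd_of_mul (hf : OrdGE f n) (hg : OrdGE g k)
    (h : HasOrd (fun t => f t * g t) (n + k)) : HasOrd f n := by
  refine ⟨hf.1, ?_⟩
  have h1 := h.2
  rw [fun_meromorphicOrderAt_mul hf.1 hg.1] at h1
  have h2 := hf.2
  have h3 := hg.2
  cases hF : meromorphicOrderAt f 0 with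
  | top => exact absurd (by rw [← h1, hF, top_add]) (WithTop.top_ne_coe (a := n + k))
  | coe a =>
    cases hG : meromorphicOrderAt g 0 with
    | top => exact absurd (by rw [← h1, hG, add_top]) (WithTop.top_ne_coe (a := n + k))
    | coe b =>
      rw [hF] at h1 h2
      rw [hG] at h1 h3
      norm_cast at h1 h2 h3 ⊢
      omega

lemma hasOrd_inv_sub (c : ℂ) : HasOrd (fun t => t⁻¹ - c) (-1) := by
  have h := hasOrd_id.inv.add_of_ordGE (ordGE_const (-c)) (by norm_num)
  simpa [sub_eq_add_neg] using h

lemma ordGE_eval_inv (p : ℂ[X]) {d : ℕ} (hd : p.natDegree ≤ d) :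
    OrdGE (fun t => p.eval t⁻¹) (-d) := by
  simp only [eval_eq_sum_range]
  have key : ∀ s : Finset ℕ, (∀ i ∈ s, i ≤ d) →
      OrdGE (fun t : ℂ => ∑ i ∈ s, p.coeff i * t⁻¹ ^ i) (-d) := by
    intro s
    induction s using Finset.induction_on with
    | empty =>
      intro _
      simpa using (ordGE_const 0).mono (show -(d : ℤ) ≤ 0 by omega)
    | insert a s ha ih =>
      intro h
      simp only [Finset.sum_insert ha]
      refine OrdGE.add (OrdGE.const_mul _ ?_) (ih fun i hi => h i (Finset.mem_insert_of_mem hi))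
      have h1 := h a (Finset.mem_insert_self _ _)
      exact (hasOrd_id.inv.pow a).ordGE.mono (by omega)
  exact key _ fun i hi => by
    have := Finset.mem_range.mp hi
    omega

lemma analyticAt_sqrt_div {f : ℂ → ℂ} (hf : AnalyticAt ℂ f 0) {c : ℂ} (hc : f 0 = c)
    (h0 : c ≠ 0) : AnalyticAt ℂ (fun t => (f t / c) ^ (1 / 2 : ℂ)) 0 :=
  (hf.div_const).cpow analyticAt_const (by simp [hc, h0])

end Order

/-! ### Local coordinates and the hyperelliptic involution. -/

section Charts

open Filter Topology

variable {R : ℂ[X]}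

/-- The hyperelliptic involution. -/
def Pt.neg : Pt R → Pt R
  | .affine ζ ξ h => .affine ζ (-ξ) (by rw [neg_sq, h])
  | .infty s => .infty (-s)

lemma Pt.affine_congr {ζ ζ' ξ ξ' : ℂ} (h : ξ ^ 2 = R.eval ζ) (h1 : ζ = ζ') (h2 : ξ = ξ') :
    Pt.affine ζ ξ h = Pt.affine ζ' ξ' (by rw [← h1, ← h2, h]) := by
  subst h1 h2; rfl

lemma Pt.exists_affine_eq {ζ ζ' ξ ξ' : ℂ} (h : ξ ^ 2 = R.eval ζ) (h1 : ζ = ζ') (h2 : ξ = ξ') :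
    ∃ h', Pt.affine ζ ξ h = Pt.affine ζ' ξ' h' := ⟨_, Pt.affine_congr h h1 h2⟩

/-- In the standard coordinates the involution is `t ↦ t` from the chart at `P` to the chart at
`σP`, except at a branch point, where it is `t ↦ -t`. Neither changes orders. -/
lemma ordAt_neg (hR : Squarefree R) (f : Pt R → ℂ) (P : Pt R) :
    (MeromorphicAt (fun t => f (localParam hR P.neg t)) 0 →
      MeromorphicAt (fun t => f (localParam hR P t).neg) 0) ∧
    meromorphicOrderAt (fun t => f (localParam hR P t).neg) 0 = ordAt hR f P.neg := by
  have same : (∀ t, (localParam hR P t).neg = localParam hR P.neg t) →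
      (MeromorphicAt (fun t => f (localParam hR P.neg t)) 0 →
        MeromorphicAt (fun t => f (localParam hR P t).neg) 0) ∧
      meromorphicOrderAt (fun t => f (localParam hR P t).neg) 0 = ordAt hR f P.neg := by
    intro h
    simp only [h]
    exact ⟨id, rfl⟩
  match P, same with
  | .infty s, same =>
    refine same fun t => ?_
    by_cases ht : t = 0
    · simp [localParam, Pt.neg, ht]
    · simp only [localParam, Pt.neg, ht, dite_false]
      refine Pt.affine_congr _ rfl ?_
      push_cast
      ring
  | .affine ζ₀ ξ₀ h, same =>
    by_cases hξ : ξ₀ = 0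
    · have hP : (Pt.affine ζ₀ ξ₀ h).neg = Pt.affine ζ₀ ξ₀ h :=
        Pt.affine_congr _ rfl (by simp [hξ])
      have e : (fun t => f (localParam hR (.affine ζ₀ ξ₀ h) t).neg) =
          (fun t => f (localParam hR (.affine ζ₀ ξ₀ h) t)) ∘ fun t => -t := by
        funext t
        simp only [Function.comp, localParam, Pt.neg, hξ, dite_true]
        congr 1
        refine Pt.affine_congr _ (by ring) ?_
        rw [neg_sq]
        ring
      have han : AnalyticAt ℂ (fun t : ℂ => -t) 0 := analyticAt_id.neg
      rw [hP, e]
      refine ⟨fun hm => MeromorphicAt.comp_analyticAt (by simpa using hm) han, ?_⟩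
      have hder : deriv (fun t : ℂ => -t) 0 ≠ 0 := by simp
      rw [meromorphicOrderAt_comp_of_deriv_ne_zero han hder, neg_zero]
      rfl
    · refine same fun t => ?_
      have hξ' : -ξ₀ ≠ 0 := neg_ne_zero.mpr hξ
      simp only [localParam, Pt.neg, hξ, hξ', dite_false]
      exact Pt.affine_congr _ rfl (by ring)

/-- A holomorphic root `l = ζ^{1/2}` and the coordinate `ξ = x`, as functions of the local
coordinate at the affine point `(ζ₀, ξ₀)`. -/
structure AffineChart (hR : Squarefree R) (ζ₀ ξ₀ : ℂ) (h : ξ₀ ^ 2 = R.eval ζ₀) (l x : ℂ → ℂ) :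
    Prop where
  analytic_l : AnalyticAt ℂ l 0
  analytic_x : AnalyticAt ℂ x 0
  l_sq : l 0 ^ 2 = ζ₀
  x_zero : x 0 = ξ₀
  param : ∀ t, ∃ h', localParam hR (.affine ζ₀ ξ₀ h) t = .affine (l t ^ 2) (x t) h'
  ord_sub : HasOrd (fun t => l t ^ 2 - ζ₀) (if ξ₀ = 0 then 2 else 1)
  ord_x : ξ₀ = 0 → HasOrd x 1
  ord_l : ζ₀ = 0 → HasOrd l 1

/-- A root of `ζ` is holomorphic in `t` everywhere on the affine part: for `ζ₀ ≠ 0` either branch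
works, and since `R(0) = 0` the point over `0` is a branch point, whose coordinate `t` already
satisfies `t² = ζ`. Prescribing `l 0` allows the branch with value `γ` to be selected later. -/
lemma exists_affineChart (hR : Squarefree R) (hR0 : R.eval 0 = 0) (ζ₀ ξ₀ : ℂ)
    (h : ξ₀ ^ 2 = R.eval ζ₀) (l₀ : ℂ) (hl₀ : l₀ ^ 2 = ζ₀) :
    ∃ l x, l 0 = l₀ ∧ AffineChart hR ζ₀ ξ₀ h l x := by
  by_cases hξ : ξ₀ = 0
  · have hRz : R.eval ζ₀ = 0 := by rw [← h, hξ]; ring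
    set T := R /ₘ (X - C ζ₀) with hT
    have hT0 : T.eval ζ₀ ≠ 0 := quot_eval_ne_zero hR hRz
    have hsub : AnalyticAt ℂ (fun t : ℂ => ζ₀ + t ^ 2) 0 := by fun_prop
    have hTa : AnalyticAt ℂ (fun t : ℂ => T.eval (ζ₀ + t ^ 2)) 0 := by
      simpa [Polynomial.aeval_def, eval₂_eq_eval_map] using hsub.aeval_polynomial T
    have hsq : AnalyticAt ℂ (fun t => sqrtNear (T.eval ζ₀) (T.eval (ζ₀ + t ^ 2))) 0 :=
      analyticAt_const.mul (analyticAt_sqrt_div hTa (by simp) hT0)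
    have hx : HasOrd (fun t => t * sqrtNear (T.eval ζ₀) (T.eval (ζ₀ + t ^ 2))) 1 := by
      simpa using hasOrd_id.mul (hasOrd_of_analyticAt hsq (by simp [sqrtNear, hT0]))
    have hxa : AnalyticAt ℂ (fun t => t * sqrtNear (T.eval ζ₀) (T.eval (ζ₀ + t ^ 2))) 0 :=
      analyticAt_id.mul hsq
    by_cases hζ : ζ₀ = 0
    · refine ⟨fun t => t, fun t => t * sqrtNear (T.eval ζ₀) (T.eval (ζ₀ + t ^ 2)), ?_,
        analyticAt_id, hxa, ?_, ?_, ?_, ?_, fun _ => hx, fun _ => hasOrd_id⟩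
      · rw [hζ] at hl₀
        exact (pow_eq_zero_iff two_ne_zero |>.mp hl₀).symm
      · simp [hζ]
      · simp [hξ]
      · intro t
        simp only [localParam, hξ, dite_true]
        exact Pt.exists_affine_eq _ (by simp [hζ]) rfl
      · simpa [hζ, hξ] using hasOrd_id.pow 2
    · have hl2 : ∀ t, (l₀ * ((ζ₀ + t ^ 2) / ζ₀) ^ (1 / 2 : ℂ)) ^ 2 = ζ₀ + t ^ 2 := fun t => by
        rw [mul_pow, sq_cpow_half, hl₀, mul_div_cancel₀ _ hζ]
      have hl0 : l₀ * ((ζ₀ + 0 ^ 2) / ζ₀) ^ (1 / 2 : ℂ) = l₀ := by simp [hζ]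
      refine ⟨fun t => l₀ * ((ζ₀ + t ^ 2) / ζ₀) ^ (1 / 2 : ℂ),
        fun t => t * sqrtNear (T.eval ζ₀) (T.eval (ζ₀ + t ^ 2)), hl0,
        analyticAt_const.mul (analyticAt_sqrt_div hsub (by simp) hζ), hxa, ?_, ?_, ?_, ?_,
        fun _ => hx, fun e => absurd e hζ⟩
      · exact (hl2 0).trans (by simp)
      · simp [hξ]
      · intro t
        simp only [localParam, hξ, dite_true]
        exact Pt.exists_affine_eq _ (hl2 t).symm rfl
      · simp only [hl2]
        simpa [hξ] using hasOrd_id.pow 2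
  · have hRz : R.eval ζ₀ ≠ 0 := by rw [← h]; exact pow_ne_zero 2 hξ
    have hζ : ζ₀ ≠ 0 := fun e => hRz (by rw [e, hR0])
    have hsub : AnalyticAt ℂ (fun t : ℂ => ζ₀ + t) 0 := by fun_prop
    have hRa : AnalyticAt ℂ (fun t : ℂ => R.eval (ζ₀ + t)) 0 := by
      simpa [Polynomial.aeval_def, eval₂_eq_eval_map] using hsub.aeval_polynomial R
    have hl2 : ∀ t, (l₀ * ((ζ₀ + t) / ζ₀) ^ (1 / 2 : ℂ)) ^ 2 = ζ₀ + t := fun t => by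
      rw [mul_pow, sq_cpow_half, hl₀, mul_div_cancel₀ _ hζ]
    have hl0 : l₀ * ((ζ₀ + 0) / ζ₀) ^ (1 / 2 : ℂ) = l₀ := by simp [hζ]
    refine ⟨fun t => l₀ * ((ζ₀ + t) / ζ₀) ^ (1 / 2 : ℂ),
      fun t => ξ₀ * (R.eval (ζ₀ + t) / R.eval ζ₀) ^ (1 / 2 : ℂ), hl0,
      analyticAt_const.mul (analyticAt_sqrt_div hsub (by simp) hζ),
      analyticAt_const.mul (analyticAt_sqrt_div hRa (by simp) hRz), ?_, ?_, ?_, ?_,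
      fun e => absurd e hξ, fun e => absurd e hζ⟩
    · exact (hl2 0).trans (by simp)
    · simp [hRz]
    · intro t
      simp only [localParam, hξ, dite_false]
      exact Pt.exists_affine_eq _ (hl2 t).symm rfl
    · simp only [hl2]
      simpa [hξ] using hasOrd_id

/-- The coordinate `ξ` at a point at infinity. -/
lemma exists_inftyChart (hR : Squarefree R) (hm : R.Monic) {n : ℕ} (hn : R.natDegree = 2 * n)
    (s : ℤˣ) : ∃ x : ℂ → ℂ, HasOrd x (-n) ∧
      ∀ t, t ≠ 0 → ∃ h', localParam hR (.infty s) t = .affine t⁻¹ (x t) h' := by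
  have h2 : R.natDegree / 2 = n := by omega
  -- For `t ≠ 0`, `t²ⁿ R(1/t)` is the reversed polynomial at `t`; its value at `t = 0` is the
  -- leading coefficient `1`, so the principal root is holomorphic there.
  have hrev : AnalyticAt ℂ (fun t : ℂ => (R.reverse.eval t / 1) ^ (1 / 2 : ℂ)) 0 := by
    refine analyticAt_sqrt_div ?_ ?_ one_ne_zero
    · exact AnalyticOnNhd.eval_polynomial R.reverse 0 (Set.mem_univ _)
    · rw [← coeff_zero_eq_eval_zero, coeff_zero_reverse, hm.leadingCoeff]
  have hrev0 : R.reverse.eval 0 = 1 := by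
    rw [← coeff_zero_eq_eval_zero, coeff_zero_reverse, hm.leadingCoeff]
  have hs : (((s : ℤ) : ℂ)) ≠ 0 := by exact_mod_cast s.ne_zero
  refine ⟨fun t => ((s : ℤ) : ℂ) * t⁻¹ ^ n * (R.reverse.eval t / 1) ^ (1 / 2 : ℂ), ?_, ?_⟩
  · have := ((hasOrd_id.inv.pow n).const_mul hs).mul
      (hasOrd_of_analyticAt hrev (by simp [hrev0]))
    simpa using this
  · intro t ht
    simp only [localParam, ht, dite_false]
    refine Pt.exists_affine_eq _ rfl ?_
    have e : t ^ (2 * (R.natDegree / 2)) * R.eval t⁻¹ = R.reverse.eval t := by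
      let : Invertible t⁻¹ := invertibleOfNonzero (inv_ne_zero ht)
      have := eval₂_reverse_mul_pow (RingHom.id ℂ) t⁻¹ R
      rw [invOf_eq_inv, inv_inv] at this
      rw [h2, ← hn, eval, ← this, mul_left_comm, ← mul_pow, mul_inv_cancel₀ ht, one_pow, mul_one]
      rfl
    rw [e, h2, div_one]

end Charts

/-! ### Multiplicities of points in a divisor. -/

section Indicator

variable {R : ℂ[X]}

/-- The multiplicity of the point `P` in the divisor `p`. -/
def mult (p P : Pt R) : ℤ := Finsupp.single p (1 : ℤ) P

lemma mult_self (p : Pt R) : mult p p = 1 := Finsupp.single_eq_same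

lemma mult_of_ne {p P : Pt R} (h : P ≠ p) : mult p P = 0 := Finsupp.single_eq_of_ne h

lemma mult_nonneg (p P : Pt R) : 0 ≤ mult p P := by
  by_cases h : P = p
  · rw [h, mult_self]; exact zero_le_one
  · rw [mult_of_ne h]

lemma Pt.affine_inj {ζ ζ' ξ ξ' : ℂ} {h : ξ ^ 2 = R.eval ζ} {h' : ξ' ^ 2 = R.eval ζ'} :
    Pt.affine ζ ξ h = Pt.affine ζ' ξ' h' ↔ ζ = ζ' ∧ ξ = ξ' :=
  ⟨fun e => by cases e; exact ⟨rfl, rfl⟩, fun e => Pt.affine_congr h e.1 e.2⟩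

lemma Pt.neg_affine {ζ ξ : ℂ} (h : ξ ^ 2 = R.eval ζ) :
    (Pt.affine ζ ξ h).neg = .affine ζ (-ξ) (by rw [neg_sq, h]) := rfl

lemma sum_mult_nonneg {ι : Type*} [Fintype ι] (p : ι → Pt R) (P : Pt R) :
    0 ≤ ∑ j, mult (p j) P := Finset.sum_nonneg fun j _ => mult_nonneg (p j) P

end Indicator

/-! ### Local orders of `ζ - ν`, of `u` and of `(ζ a + κ ξ) / λ` at affine points. -/

section LocalOrders

open Filter Topology

/-- If `ζ(t) - c` has finite order for every `c`, then so has a nonzero polynomial in `ζ(t)`. -/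
lemma eventually_eval_ne_zero {ζ : ℂ → ℂ} (h : ∀ c, ∃ n, HasOrd (fun t => ζ t - c) n)
    {p : ℂ[X]} (hp : p ≠ 0) : ∀ᶠ t in 𝓝[≠] (0 : ℂ), p.eval (ζ t) ≠ 0 := by
  classical
  have h1 : ∀ᶠ t in 𝓝[≠] (0 : ℂ), ∀ c ∈ p.roots.toFinset, ζ t - c ≠ 0 :=
    (Filter.eventually_all_finset _).mpr fun c _ => (h c).choose_spec.eventually_ne
  filter_upwards [h1] with t ht h0
  exact ht (ζ t) (by simp [hp, h0]) (sub_self _)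

variable {R : ℂ[X]} {hR : Squarefree R} {ζ₀ ξ₀ : ℂ} {h : ξ₀ ^ 2 = R.eval ζ₀} {l x : ℂ → ℂ}

namespace AffineChart

lemma analyticAt_eval (hc : AffineChart hR ζ₀ ξ₀ h l x) (p : ℂ[X]) :
    AnalyticAt ℂ (fun t => p.eval (l t ^ 2)) 0 := by
  simpa [Polynomial.aeval_def, eval₂_eq_eval_map] using (hc.analytic_l.pow 2).aeval_polynomial p

lemma sq_eq (hc : AffineChart hR ζ₀ ξ₀ h l x) (t : ℂ) : x t ^ 2 = R.eval (l t ^ 2) :=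
  (hc.param t).choose

/-- The order of `ζ - ν` in terms of the two points over `ν`. -/
lemma hasOrd_sub (hc : AffineChart hR ζ₀ ξ₀ h l x) {ν ξ : ℂ} (hν : ξ ^ 2 = R.eval ν) :
    HasOrd (fun t => l t ^ 2 - ν) (mult (.affine ν ξ hν) (.affine ζ₀ ξ₀ h) +
      mult (.affine ν ξ hν) (Pt.affine ζ₀ ξ₀ h).neg) := by
  by_cases e : ζ₀ = ν
  · subst e
    have hsq : ξ₀ ^ 2 = ξ ^ 2 := h.trans hν.symm
    have := hc.ord_sub
    by_cases h0 : ξ₀ = 0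
    · have h1 : ξ = 0 := by simpa [h0] using hsq.symm
      have e1 : (Pt.affine ζ₀ ξ₀ h) = .affine ζ₀ ξ hν := Pt.affine_congr _ rfl (by rw [h0, h1])
      have e2 : (Pt.affine ζ₀ ξ₀ h).neg = .affine ζ₀ ξ hν :=
        Pt.affine_congr _ rfl (by rw [h0, h1, neg_zero])
      rw [e2, e1, mult_self]
      simpa [h0] using this
    · rw [if_neg h0] at this
      have h2 : ξ₀ ≠ -ξ₀ := fun e => h0 (by linear_combination (1 / 2 : ℂ) * e)
      rcases sq_eq_sq_iff_eq_or_eq_neg.mp hsq with h1 | h1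
      · subst h1
        rw [mult_self, Pt.neg_affine, mult_of_ne (fun e => h2 (Pt.affine_inj.mp e).2.symm)]
        simpa using this
      · have e2 : (Pt.affine ζ₀ ξ₀ h).neg = .affine ζ₀ ξ hν :=
          Pt.affine_congr _ rfl (by rw [h1, neg_neg])
        rw [e2, mult_self,
          mult_of_ne (fun e => h2 ((Pt.affine_inj.mp e).2.trans (by rw [h1, neg_neg])))]
        simpa using this
  · rw [Pt.neg_affine, mult_of_ne (fun e' => e (Pt.affine_inj.mp e').1),
      mult_of_ne (fun e' => e (Pt.affine_inj.mp e').1)]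
    exact hasOrd_of_analyticAt ((hc.analytic_l.pow 2).sub analyticAt_const)
      (by simpa [hc.l_sq] using sub_ne_zero.mpr e)

lemma exists_hasOrd_sub (hc : AffineChart hR ζ₀ ξ₀ h l x) (c : ℂ) :
    ∃ n, HasOrd (fun t => l t ^ 2 - c) n := by
  have h1 : ((R.eval c) ^ (1 / 2 : ℂ)) ^ 2 = R.eval c := sq_cpow_half _
  exact ⟨_, hc.hasOrd_sub h1⟩

lemma eventually_eval_ne (hc : AffineChart hR ζ₀ ξ₀ h l x) {p : ℂ[X]} (hp : p ≠ 0) :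
    ∀ᶠ t in 𝓝[≠] (0 : ℂ), p.eval (l t ^ 2) ≠ 0 :=
  eventually_eval_ne_zero hc.exists_hasOrd_sub hp

lemma eventually_l_ne (hc : AffineChart hR ζ₀ ξ₀ h l x) : ∀ᶠ t in 𝓝[≠] (0 : ℂ), l t ≠ 0 := by
  filter_upwards [hc.eventually_eval_ne X_ne_zero] with t ht e
  simp [e] at ht

lemma ordGE_eval (hc : AffineChart hR ζ₀ ξ₀ h l x) {p : ℂ[X]} (hp : p.eval ζ₀ = 0) :
    OrdGE (fun t => p.eval (l t ^ 2)) (if ξ₀ = 0 then 2 else 1) := by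
  simp only [eval_eq_sub_mul hp]
  simpa using hc.ord_sub.ordGE.mul (ordGE_of_analyticAt (hc.analyticAt_eval (p /ₘ (X - C ζ₀))))

lemma hasOrd_l (hc : AffineChart hR ζ₀ ξ₀ h l x) (h0 : ζ₀ ≠ 0) : HasOrd l 0 :=
  hasOrd_of_analyticAt hc.analytic_l fun e => h0 (by rw [← hc.l_sq, e]; ring)

/-- The first component `(ζ a + κ ξ) / λ` of the eigenvector of the Lax matrix is holomorphic. -/
lemma eigen_ordGE_zero (hc : AffineChart hR ζ₀ ξ₀ h l x) (hR0 : R.eval 0 = 0) (κ : ℂ) (a : ℂ[X]) :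
    OrdGE (fun t => (l t ^ 2 * a.eval (l t ^ 2) + κ * x t) * (l t)⁻¹) 0 := by
  by_cases h0 : ζ₀ = 0
  · have hξ : ξ₀ = 0 := by
      rw [h0, hR0] at h
      exact (pow_eq_zero_iff two_ne_zero).mp h
    have h1 := hc.ordGE_eval (p := X * a) (by simp [h0])
    rw [if_pos hξ] at h1
    simp only [eval_mul, eval_X] at h1
    simpa using ((h1.mono one_le_two).add ((hc.ord_x hξ).ordGE.const_mul κ)).mul
      (hc.ord_l h0).inv.ordGE
  · have h1 : OrdGE (fun t => l t ^ 2 * a.eval (l t ^ 2) + κ * x t) 0 :=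
      ordGE_of_analyticAt (((hc.analytic_l.pow 2).mul (hc.analyticAt_eval a)).add
        (analyticAt_const.mul hc.analytic_x))
    simpa using h1.mul (hc.hasOrd_l h0).inv.ordGE

end AffineChart

variable {ι : Type*} [Fintype ι] {a w u : ℂ[X]} {κ A : ℂ} {nu xi : ι → ℂ}

lemma AffineChart.hasOrd_lower (hc : AffineChart hR ζ₀ ξ₀ h l x) (hA : A ≠ 0)
    (hu : u = C A * ∏ j, (X - C (nu j))) (hxi : ∀ j, xi j ^ 2 = R.eval (nu j)) :
    HasOrd (fun t => u.eval (l t ^ 2)) (∑ j, mult (.affine (nu j) (xi j) (hxi j)) (.affine ζ₀ ξ₀ h)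
      + ∑ j, mult (.affine (nu j) (xi j) (hxi j)) (Pt.affine ζ₀ ξ₀ h).neg) := by
  rw [hu, ← Finset.sum_add_distrib]
  simp only [eval_mul, eval_C, eval_prod, eval_sub, eval_X]
  exact (HasOrd.prod _ fun j _ => hc.hasOrd_sub (hxi j)).const_mul hA

/-- Orders of the first component of the eigenvector at the points over the zeros of `u`. -/
lemma AffineChart.eigen_ord (hc : AffineChart hR ζ₀ ξ₀ h l x) (hR0 : R.eval 0 = 0) (hκ : κ ≠ 0)
    (hN : C (κ ^ 2) * R = X * (X * a ^ 2 + w * u)) (hA : A ≠ 0)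
    (hu : u = C A * ∏ j, (X - C (nu j))) (hxi : ∀ j, xi j ^ 2 = R.eval (nu j))
    (hxi' : ∀ j, κ * xi j = nu j * a.eval (nu j)) :
    OrdGE (fun t => (l t ^ 2 * a.eval (l t ^ 2) + κ * x t) * (l t)⁻¹)
      (∑ j, mult (.affine (nu j) (xi j) (hxi j)) (Pt.affine ζ₀ ξ₀ h).neg) ∧
    (∑ j, mult (.affine (nu j) (xi j) (hxi j)) (.affine ζ₀ ξ₀ h) ≠ 0 →
      ∃ k ≤ ∑ j, mult (.affine (nu j) (xi j) (hxi j)) (Pt.affine ζ₀ ξ₀ h).neg,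
        HasOrd (fun t => (l t ^ 2 * a.eval (l t ^ 2) + κ * x t) * (l t)⁻¹) k) := by
  have hU := hc.hasOrd_lower hA hu hxi
  have hn := sum_mult_nonneg (fun j => Pt.affine (nu j) (xi j) (hxi j)) (.affine ζ₀ ξ₀ h)
  have hn' := sum_mult_nonneg (fun j => Pt.affine (nu j) (xi j) (hxi j)) (Pt.affine ζ₀ ξ₀ h).neg
  by_cases hu0 : u.eval ζ₀ = 0
  swap
  · have h1 : HasOrd (fun t => u.eval (l t ^ 2)) 0 :=
      hasOrd_of_analyticAt (hc.analyticAt_eval u) (by rwa [hc.l_sq])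
    have h2 := hU.unique h1
    have h3 := hc.eigen_ordGE_zero hR0 κ a
    exact ⟨h3.mono (by omega), fun h4 => absurd (show _ = (0 : ℤ) by omega) h4⟩
  -- If `u(0) = 0`, then `X²` would divide `R`, against squarefreeness.
  have hζ : ζ₀ ≠ 0 := by
    rintro rfl
    have h1 : X ∣ X * a ^ 2 + w * u := by
      rw [X_dvd_iff, coeff_zero_eq_eval_zero]
      simp [hu0]
    obtain ⟨T, hT⟩ := h1
    refine not_isUnit_X (hR X ⟨C (κ ^ 2)⁻¹ * T, ?_⟩)
    have h2 : C (κ ^ 2)⁻¹ * C (κ ^ 2) = (1 : ℂ[X]) := by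
      rw [← C_mul, inv_mul_cancel₀ (pow_ne_zero 2 hκ), C_1]
    rw [hT] at hN
    linear_combination C (κ ^ 2)⁻¹ * hN - R * h2
  obtain ⟨i, hi⟩ : ∃ i, nu i = ζ₀ := by
    rw [hu] at hu0
    simp only [eval_mul, eval_C, eval_prod, eval_sub, eval_X, mul_eq_zero, hA, false_or,
      Finset.prod_eq_zero_iff, Finset.mem_univ, true_and] at hu0
    obtain ⟨i, hi⟩ := hu0
    exact ⟨i, (sub_eq_zero.mp hi).symm⟩
  have hl := hc.hasOrd_l hζ
  -- On the curve `(κξ + ζa)(κξ - ζa) = ζ w u`; the question is how the zeros of `u` are shared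
  -- between the two factors.
  have hprod : ∀ t, (l t ^ 2 * a.eval (l t ^ 2) + κ * x t) *
      (κ * x t + -1 * (l t ^ 2 * a.eval (l t ^ 2))) =
      l t ^ 2 * w.eval (l t ^ 2) * u.eval (l t ^ 2) := fun t => by
    have h1 := congrArg (eval (l t ^ 2)) hN
    simp only [eval_mul, eval_C, eval_X, eval_add, eval_pow] at h1
    rw [← hc.sq_eq t] at h1
    linear_combination h1
  have ha : AnalyticAt ℂ (fun t => l t ^ 2 * a.eval (l t ^ 2)) 0 :=
    (hc.analytic_l.pow 2).mul (hc.analyticAt_eval a)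
  have hx : AnalyticAt ℂ (fun t => κ * x t) 0 := analyticAt_const.mul hc.analytic_x
  have hw : OrdGE (fun t => l t ^ 2 * w.eval (l t ^ 2)) 0 :=
    ordGE_of_analyticAt ((hc.analytic_l.pow 2).mul (hc.analyticAt_eval w))
  have hwu := hw.mul hU.ordGE
  by_cases hξ : ξ₀ = 0
  · have hPn : (Pt.affine ζ₀ ξ₀ h).neg = .affine ζ₀ ξ₀ h :=
      Pt.affine_congr _ rfl (by simp [hξ])
    rw [hPn] at hwu hn' ⊢
    have ha0 : a.eval ζ₀ = 0 := by
      have h1 : xi i = 0 := by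
        have := hxi i
        rw [hi, ← h, hξ] at this
        simpa using this
      have h2 := hxi' i
      rw [h1, hi] at h2
      simpa [hζ] using h2.symm
    have hx1 : HasOrd (fun t => κ * x t) 1 := (hc.ord_x hξ).const_mul hκ
    have ha2 : OrdGE (fun t => l t ^ 2 * a.eval (l t ^ 2)) 2 := by
      have := hc.ordGE_eval (p := X * a) (by simp [ha0])
      simpa [hξ] using this
    have hY : HasOrd (fun t => l t ^ 2 * a.eval (l t ^ 2) + κ * x t) 1 := by
      simpa only [add_comm] using hx1.add_of_ordGE ha2 one_lt_two
    have hZ := hx1.add_of_ordGE (ha2.const_mul (-1)) one_lt_two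
    have hYZ := hY.mul hZ
    simp only [hprod] at hYZ
    -- At a branch point both factors have order exactly `1`, so `u` has order at most `2` in `t`:
    -- at most one `ν_j` lies there.
    have hle := hYZ.le_of_ordGE hwu
    have hE := hY.mul hl.inv
    exact ⟨hE.ordGE.mono (by omega), fun h4 => ⟨_, by omega, hE⟩⟩
  · have hi2 := hxi i
    have hi3 := hxi' i
    rw [hi] at hi2 hi3
    -- Away from branch points only one factor can vanish. At `𝔭(ν²)` itself `ζa + κξ = 2κξ₀ ≠ 0`;
    -- at the conjugate point `κξ - ζa = 2κξ₀ ≠ 0`, so `ζa + κξ` takes all the zeros of `u`.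
    rcases sq_eq_sq_iff_eq_or_eq_neg.mp (h.trans hi2.symm) with e | e
    · have hn0 : ∑ j, mult (.affine (nu j) (xi j) (hxi j)) (Pt.affine ζ₀ ξ₀ h).neg = 0 := by
        refine Finset.sum_eq_zero fun j _ => mult_of_ne fun e' => hξ ?_
        obtain ⟨e1, e2⟩ := Pt.affine_inj.mp e'
        have h3 := hxi' j
        rw [← e1, ← e2, ← hi3, ← e] at h3
        have := mul_left_cancel₀ hκ h3
        linear_combination -(1 / 2 : ℂ) * this
      rw [hn0]
      have hY : HasOrd (fun t => l t ^ 2 * a.eval (l t ^ 2) + κ * x t) 0 := by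
        refine hasOrd_of_analyticAt (ha.add hx) ?_
        rw [hc.l_sq, hc.x_zero, ← hi3, ← e]
        intro h0
        exact hξ ((mul_eq_zero.mp (show κ * ξ₀ = 0 by
          linear_combination (1 / 2 : ℂ) * h0)).resolve_left hκ)
      have hE := hY.mul hl.inv
      exact ⟨hE.ordGE, fun _ => ⟨_, le_refl _, by simpa using hE⟩⟩
    · have hn0 : ∑ j, mult (.affine (nu j) (xi j) (hxi j)) (.affine ζ₀ ξ₀ h) = 0 := by
        refine Finset.sum_eq_zero fun j _ => mult_of_ne fun e' => hξ ?_
        obtain ⟨e1, e2⟩ := Pt.affine_inj.mp e'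
        have h3 := hxi' j
        rw [← e1, ← e2, ← hi3] at h3
        have := mul_left_cancel₀ hκ h3
        linear_combination (1 / 2 : ℂ) * (this + e)
      have hZ : HasOrd (fun t => κ * x t + -1 * (l t ^ 2 * a.eval (l t ^ 2))) 0 := by
        refine hasOrd_of_analyticAt (hx.add (analyticAt_const.mul ha)) ?_
        rw [hc.l_sq, hc.x_zero, ← hi3, e]
        intro h0
        refine hξ ((mul_eq_zero.mp (show κ * ξ₀ = 0 by
          rw [e]; linear_combination (1 / 2 : ℂ) * h0)).resolve_left hκ)
      have hY := OrdGE.of_mul hwu hZ (Eventually.of_forall hprod)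
      exact ⟨(hY.mul hl.inv.ordGE).mono (by omega), fun h4 => absurd hn0 h4⟩

end LocalOrders

/-! ### Sharpness of lower bounds from the norm. -/

section Criterion

variable {R : ℂ[X]}

/-- Lower bounds `D` for the orders of `f` are sharp if they are so for the norm `f · (f ∘ σ)`, where
`σ` is the hyperelliptic involution. -/
lemma hasDivisor_of_norm (hR : Squarefree R) (f : Pt R → ℂ) (D : Pt R →₀ ℤ)
    (h1 : ∀ P, OrdGE (fun t => f (localParam hR P t)) (D P))
    (h2 : ∀ P, HasOrd (fun t => f (localParam hR P t) * f (localParam hR P t).neg)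
      (D P + D P.neg)) : HasDivisor hR f D := by
  refine ⟨fun P => (h1 P).1, fun P => ?_⟩
  have h3 : OrdGE (fun t => f (localParam hR P t).neg) (D P.neg) :=
    ⟨(ordAt_neg hR f P).1 (h1 P.neg).1, by rw [(ordAt_neg hR f P).2]; exact (h1 P.neg).2⟩
  exact ((h1 P).hasOrd_of_mul h3 (h2 P)).2

end Criterion

/-- The standing assumptions on the flow and on its spectral curve. -/
structure Setting {g : ℕ} (α : Fin (g + 1) → ℂ) (γ ε : ℂ) (z₀ : Phase (g + 1)) (κ : ℂ)
    (zk : Fin g → ℂ) (m : ℕ) : Prop where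
  α_ne : ∀ j, α j ≠ 0
  α_inj : Function.Injective fun j => α j ^ 2
  γ_ne : ∀ j, γ ^ 2 ≠ α j ^ 2
  ε_eq : ε = 1 ∨ ε = -1
  F1_ne : F1 α z₀ ≠ 0
  κ_sq : κ ^ 2 = -F1 α z₀
  genF_eq : ∀ lam : ℂ, (∀ j, lam ^ 2 ≠ α j ^ 2) →
      genF α lam z₀ = F1 α z₀ * (∏ k, (lam ^ 2 - zk k)) / alphaFun α (lam ^ 2)
  flow_def : FlowDefined α γ ε z₀ m

/-! ### The spectral curve and the eigenvector `h₊` over it. -/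

section Curve

variable {g : ℕ} {α : Fin (g + 1) → ℂ} {zk : Fin g → ℂ}

lemma curvePoly_eval_zero : (curvePoly α zk).eval 0 = 0 := by simp [curvePoly]

lemma curvePoly_monic : (curvePoly α zk).Monic :=
  (monic_X.mul (monic_prod_of_monic _ _ fun _ _ => monic_X_sub_C _)).mul
    (monic_prod_of_monic _ _ fun _ _ => monic_X_sub_C _)

lemma natDegree_curvePoly : (curvePoly α zk).natDegree = 2 * (g + 1) := by
  rw [curvePoly, Monic.natDegree_mul (monic_X.mul (monic_prod_of_monic _ _ fun _ _ =>
      monic_X_sub_C _)) (monic_prod_of_monic _ _ fun _ _ => monic_X_sub_C _),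
    Monic.natDegree_mul monic_X (monic_prod_of_monic _ _ fun _ _ => monic_X_sub_C _),
    natDegree_X, natDegree_prod_of_monic _ _ (fun _ _ => monic_X_sub_C _),
    natDegree_prod_of_monic _ _ (fun _ _ => monic_X_sub_C _)]
  simp only [natDegree_X_sub_C, Finset.sum_const, Finset.card_univ, Fintype.card_fin, smul_eq_mul]
  ring

end Curve

namespace Setting

variable {g : ℕ} {α : Fin (g + 1) → ℂ} {γ ε : ℂ} {z₀ : Phase (g + 1)} {κ : ℂ}
  {zk : Fin g → ℂ} {m : ℕ}

lemma mono {i : ℕ} (s : Setting α γ ε z₀ κ zk m) (hi : i ≤ m) : Setting α γ ε z₀ κ zk i :=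
  { s with flow_def := s.flow_def.mono hi }

lemma κ_ne (s : Setting α γ ε z₀ κ zk m) : κ ≠ 0 := by
  rintro rfl
  have := s.κ_sq
  exact s.F1_ne (by simpa using this)

/-- The spectral curve in terms of the entries of the Lax matrix at time `m`. -/
lemma curve_eq (s : Setting α γ ε z₀ κ zk m) :
    C (κ ^ 2) * curvePoly α zk = X * normPoly α (flow α γ ε z₀ m) := by
  rw [normPoly_flow s.γ_ne s.ε_eq s.flow_def]
  have h : normPoly α z₀ = C (κ ^ 2) * (alphaPoly α * ∏ k, (X - C (zk k))) := by
    refine poly_eq_of_eval_sq (alphaPoly_monic (α := α)).ne_zero fun lam hl => ?_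
    rw [alphaPoly_eval] at hl
    rw [normPoly_eval _ hl, s.genF_eq lam (ne_of_alphaFun_ne_zero hl), s.κ_sq]
    simp only [eval_mul, eval_C, alphaPoly_eval, eval_prod, eval_sub, eval_X]
    field_simp
  rw [h, curvePoly, alphaPoly]
  ring

lemma curve_eval (s : Setting α γ ε z₀ κ zk m) (ζ : ℂ) :
    κ ^ 2 * (curvePoly α zk).eval ζ = ζ * (ζ * (diagPoly α (flow α γ ε z₀ m)).eval ζ ^ 2 +
      (upperPoly α (flow α γ ε z₀ m)).eval ζ * (lowerPoly α (flow α γ ε z₀ m)).eval ζ) := by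
  have := congrArg (eval ζ) s.curve_eq
  simpa [normPoly] using this

/-- Away from the poles this is the definition with denominators cleared. At `ν = αⱼ²` the sum in
`xiNu` contains a division by zero, but the prefactor `α(ν)` vanishes, and so does `a(ν)` because
`u(ν) = 0` forces `q_j = 0`. -/
lemma κ_mul_xiNu (s : Setting α γ ε z₀ κ zk m) {z : Phase (g + 1)} {ν : ℂ}
    (h : (lowerPoly α z).eval ν = 0) :
    κ * xiNu α κ z ν = ν * (diagPoly α z).eval ν := by
  rw [xiNu, mul_div_cancel₀ _ s.κ_ne]
  by_cases h0 : alphaFun α ν = 0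
  · obtain ⟨j, -, hj⟩ := Finset.prod_eq_zero_iff.mp h0
    rw [sub_eq_zero.mp hj] at h ⊢
    rw [diagPoly_eval_pole s.α_ne s.α_inj h, alphaFun_eq_zero]
    ring
  · rw [diagPoly, numer_eval _ h0, mul_assoc]
    rfl

/-- At a zero of `u` the curve equation degenerates to `κ² R(ν) = (ν a(ν))²`. -/
lemma xiNu_sq (s : Setting α γ ε z₀ κ zk m) {ν : ℂ}
    (h : (lowerPoly α (flow α γ ε z₀ m)).eval ν = 0) :
    xiNu α κ (flow α γ ε z₀ m) ν ^ 2 = (curvePoly α zk).eval ν := by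
  apply mul_left_cancel₀ (pow_ne_zero 2 s.κ_ne)
  rw [s.curve_eval, h]
  linear_combination (κ * xiNu α κ (flow α γ ε z₀ m) ν +
    ν * (diagPoly α (flow α γ ε z₀ m)).eval ν) * s.κ_mul_xiNu h

lemma alphaFun_γ_ne (s : Setting α γ ε z₀ κ zk m) : alphaFun α (γ ^ 2) ≠ 0 :=
  alphaFun_ne_zero s.γ_ne

lemma genF_flow (s : Setting α γ ε z₀ κ zk m) {lam : ℂ} (hl : alphaFun α (lam ^ 2) ≠ 0) :
    genF α lam (flow α γ ε z₀ m) = genF α lam z₀ := by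
  have h := normPoly_eval (flow α γ ε z₀ m) hl
  rw [normPoly_flow s.γ_ne s.ε_eq s.flow_def, normPoly_eval _ hl] at h
  exact (neg_inj.mp (mul_right_cancel₀ (pow_ne_zero 2 hl) h)).symm

lemma κ_mul_xiGamma (s : Setting α γ ε z₀ κ zk m) : κ * xiGamma α γ ε κ z₀ =
    -(γ * alphaFun α (γ ^ 2) * (ε * (-genF α γ z₀) ^ (1 / 2 : ℂ))) := by
  rw [xiGamma, mul_div_cancel₀ _ s.κ_ne]

/-- The equation of the curve in terms of `det L₀`. -/
lemma κ_sq_mul_eval (s : Setting α γ ε z₀ κ zk m) {lam : ℂ} (hl : alphaFun α (lam ^ 2) ≠ 0) :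
    κ ^ 2 * (curvePoly α zk).eval (lam ^ 2) =
      lam ^ 2 * (-genF α lam z₀ * alphaFun α (lam ^ 2) ^ 2) := by
  have h := congrArg (eval (lam ^ 2)) s.curve_eq
  rw [normPoly_flow s.γ_ne s.ε_eq s.flow_def, eval_mul, eval_mul, normPoly_eval _ hl] at h
  simpa using h

lemma xiGamma_sq (s : Setting α γ ε z₀ κ zk m) :
    xiGamma α γ ε κ z₀ ^ 2 = (curvePoly α zk).eval (γ ^ 2) := by
  apply mul_left_cancel₀ (pow_ne_zero 2 s.κ_ne)
  rw [s.κ_sq_mul_eval s.alphaFun_γ_ne, ← mul_pow, s.κ_mul_xiGamma, neg_sq, mul_pow, mul_pow,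
    mul_pow, sq_cpow_half]
  rcases s.ε_eq with rfl | rfl <;> ring

lemma rho_sq (s : Setting α γ ε z₀ κ zk m) {lam ξ : ℂ} (h0 : lam ≠ 0)
    (hl : alphaFun α (lam ^ 2) ≠ 0) (h : ξ ^ 2 = (curvePoly α zk).eval (lam ^ 2)) :
    rho α κ lam ξ ^ 2 = -genF α lam z₀ := by
  rw [rho, div_pow, mul_pow, h, s.κ_sq_mul_eval hl]
  field_simp

/-- The eigenvector `h₊(m, λ)` is proportional to `((ζ a + κ ξ) / λ, u)`. -/
lemma hEig_mul_lower (s : Setting α γ ε z₀ κ zk m) {lam ξ : ℂ} (h0 : lam ≠ 0)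
    (hl : alphaFun α (lam ^ 2) ≠ 0) (hu : (lowerPoly α z₀).eval (lam ^ 2) ≠ 0)
    (h : ξ ^ 2 = (curvePoly α zk).eval (lam ^ 2)) :
    hEig α γ ε z₀ 1 m lam (rho α κ lam ξ) 0 * (lowerPoly α (flow α γ ε z₀ m)).eval (lam ^ 2) =
    hEig α γ ε z₀ 1 m lam (rho α κ lam ξ) 1 *
      ((lam ^ 2 * (diagPoly α (flow α γ ε z₀ m)).eval (lam ^ 2) + κ * ξ) * lam⁻¹) := by
  rw [← L10_mul _ hl] at hu ⊢
  have h1 := L_flow_hEig s.γ_ne s.ε_eq (ne_of_alphaFun_ne_zero hl) s.flow_def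
    (left_ne_zero_of_mul hu) (s.rho_sq h0 hl h)
  have h2 := L00_mul (flow α γ ε z₀ m) hl
  have h3 : rho α κ lam ξ * alphaFun α (lam ^ 2) = κ * ξ * lam⁻¹ := by
    rw [rho]
    field_simp
  have h4 : lam * lam⁻¹ = 1 := mul_inv_cancel₀ h0
  linear_combination alphaFun α (lam ^ 2) * h1 + hEig α γ ε z₀ 1 m lam (rho α κ lam ξ) 1 *
    (h2 + h3) - hEig α γ ε z₀ 1 m lam (rho α κ lam ξ) 1 * lam *
      (diagPoly α (flow α γ ε z₀ m)).eval (lam ^ 2) * h4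

lemma hEig_mul_hEig (s : Setting α γ ε z₀ κ zk m) {lam ξ : ℂ} (h0 : lam ≠ 0)
    (hl : alphaFun α (lam ^ 2) ≠ 0) (hu : (lowerPoly α z₀).eval (lam ^ 2) ≠ 0)
    (h : ξ ^ 2 = (curvePoly α zk).eval (lam ^ 2)) :
    hEig α γ ε z₀ 1 m lam (rho α κ lam ξ) 1 * hEig α γ ε z₀ (-1) m lam (rho α κ lam ξ) 1 =
      (lam ^ 2 - γ ^ 2) ^ m * (lowerPoly α (flow α γ ε z₀ m)).eval (lam ^ 2) *
        ((lowerPoly α z₀).eval (lam ^ 2))⁻¹ := by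
  rw [eq_mul_inv_iff_mul_eq₀ hu]
  rw [← L10_mul _ hl] at hu ⊢
  rw [← L10_mul _ hl]
  have h1 := hEig_mul_hEig_neg s.γ_ne s.ε_eq (ne_of_alphaFun_ne_zero hl) s.flow_def
    (left_ne_zero_of_mul hu) (s.rho_sq h0 hl h)
  linear_combination alphaFun α (lam ^ 2) * h1

end Setting

/-! ### The Baker function on the curve and its norm. -/

section Baker

variable {g : ℕ} {α : Fin (g + 1) → ℂ} {γ ε : ℂ} {z₀ : Phase (g + 1)} {κ : ℂ}
  {zk : Fin g → ℂ} {m : ℕ}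

lemma rho_neg (lam ξ : ℂ) : rho α κ lam (-ξ) = -rho α κ lam ξ := by
  rw [rho, rho]; ring

lemma rho_neg_lam (lam ξ : ℂ) : rho α κ (-lam) ξ = -rho α κ lam ξ := by
  rw [rho, rho, neg_sq, neg_mul, div_neg]

/-- The Baker function does not depend on the choice of the root `λ = ζ^{1/2}`. -/
theorem baker_apply (lam ξ : ℂ) (h : ξ ^ 2 = (curvePoly α zk).eval (lam ^ 2)) :
    baker α γ ε κ z₀ zk m (.affine (lam ^ 2) ξ h) =
      (if Even m then 1 else lam) * hEig α γ ε z₀ 1 m lam (rho α κ lam ξ) 1 := by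
  rw [baker]
  rcases sq_eq_sq_iff_eq_or_eq_neg.mp (sq_cpow_half (lam ^ 2)) with e | e
  · rw [e]
  · rw [e, rho_neg_lam, (hEig_neg_lam 1 lam _ m).2]
    split_ifs with hm
    · rw [hm.neg_one_pow]; ring
    · rw [(Nat.not_even_iff_odd.mp hm).neg_one_pow]; ring

theorem baker_apply_neg (lam ξ : ℂ) (h : (-ξ) ^ 2 = (curvePoly α zk).eval (lam ^ 2)) :
    baker α γ ε κ z₀ zk m (.affine (lam ^ 2) (-ξ) h) =
      (if Even m then 1 else lam) * hEig α γ ε z₀ (-1) m lam (rho α κ lam ξ) 1 := by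
  rw [baker_apply, rho_neg, hEig_neg]

/-- The norm of the Baker function. -/
theorem baker_mul_baker_neg (s : Setting α γ ε z₀ κ zk m) {ζ ξ : ℂ} (h0 : ζ ≠ 0)
    (hl : alphaFun α ζ ≠ 0) (hu : (lowerPoly α z₀).eval ζ ≠ 0)
    (h : ξ ^ 2 = (curvePoly α zk).eval ζ) :
    baker α γ ε κ z₀ zk m (.affine ζ ξ h) * baker α γ ε κ z₀ zk m (Pt.affine ζ ξ h).neg =
      (if Even m then 1 else ζ) * ((ζ - γ ^ 2) ^ m *
        (lowerPoly α (flow α γ ε z₀ m)).eval ζ * ((lowerPoly α z₀).eval ζ)⁻¹) := by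
  obtain ⟨lam, rfl⟩ : ∃ lam, ζ = lam ^ 2 := ⟨_, (sq_cpow_half ζ).symm⟩
  rw [Pt.neg_affine, baker_apply, baker_apply_neg,
    ← s.hEig_mul_hEig (by simpa using h0) hl hu h]
  split_ifs <;> ring

end Baker

/-! ### Lower bounds for the order of the Baker function. -/

section Local

open Filter Topology

variable {g : ℕ} {α : Fin (g + 1) → ℂ} {γ ε : ℂ} {z₀ : Phase (g + 1)} {κ : ℂ}
  {zk : Fin g → ℂ} {m : ℕ}

section Affine

variable {hR : Squarefree (curvePoly α zk)} {ζ₀ ξ₀ : ℂ}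
  {h : ξ₀ ^ 2 = (curvePoly α zk).eval ζ₀} {l x : ℂ → ℂ}

lemma AffineChart.eventually_regular (hc : AffineChart hR ζ₀ ξ₀ h l x)
    (hu : lowerPoly α z₀ ≠ 0) : ∀ᶠ t in 𝓝[≠] (0 : ℂ),
      l t ≠ 0 ∧ alphaFun α (l t ^ 2) ≠ 0 ∧ (lowerPoly α z₀).eval (l t ^ 2) ≠ 0 := by
  filter_upwards [hc.eventually_l_ne, hc.eventually_eval_ne (alphaPoly_monic (α := α)).ne_zero,
    hc.eventually_eval_ne hu] with t h1 h2 h3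
  exact ⟨h1, by rwa [alphaPoly_eval] at h2, h3⟩

/-- The Darboux matrices are holomorphic in `t`, so the bound for `c⁺` propagates. Here `c⁺` is `(ζ
a + κ ξ) / λ` over `u`: the zeros of `u` at the conjugates of the `𝔭(ν_j²)` are cancelled by the
numerator, leaving poles only at the points themselves. -/
lemma ordGE_hEig (s : Setting α γ ε z₀ κ zk 0) (hc : AffineChart hR ζ₀ ξ₀ h l x)
    (hA : Aqq α z₀ ≠ 0) {nu : Fin g → ℂ}
    (hu : lowerPoly α z₀ = C (Aqq α z₀) * ∏ j, (X - C (nu j)))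
    (hu0 : lowerPoly α z₀ ≠ 0)
    (hxi : ∀ j, xiNu α κ z₀ (nu j) ^ 2 = (curvePoly α zk).eval (nu j))
    (hxi' : ∀ j, κ * xiNu α κ z₀ (nu j) = nu j * (diagPoly α z₀).eval (nu j)) : ∀ i : ℕ,
    OrdGE (fun t => hEig α γ ε z₀ 1 i (l t) (rho α κ (l t) (x t)) 0)
      (-∑ j, mult (.affine (nu j) (xiNu α κ z₀ (nu j)) (hxi j)) (.affine ζ₀ ξ₀ h)) ∧
    OrdGE (fun t => hEig α γ ε z₀ 1 i (l t) (rho α κ (l t) (x t)) 1)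
      (-∑ j, mult (.affine (nu j) (xiNu α κ z₀ (nu j)) (hxi j)) (.affine ζ₀ ξ₀ h))
  | 0 => by
    have hn := sum_mult_nonneg (fun j => Pt.affine (nu j) (xiNu α κ z₀ (nu j)) (hxi j))
      (.affine ζ₀ ξ₀ h)
    constructor
    · have h1 := (hc.eigen_ord curvePoly_eval_zero s.κ_ne s.curve_eq hA hu hxi hxi').1
      refine (OrdGE.of_mul h1 (hc.hasOrd_lower hA hu hxi) ?_).mono (by omega)
      filter_upwards [hc.eventually_regular hu0] with t ⟨t1, t2, t3⟩
      have := s.hEig_mul_lower t1 t2 t3 (hc.sq_eq t)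
      simpa [hEig_zero, flow] using this
    · simpa [hEig_zero] using (ordGE_const 1).mono (neg_nonpos.mpr hn)
  | i + 1 => by
    obtain ⟨h0, h1⟩ := ordGE_hEig s hc hA hu hu0 hxi hxi' i
    have hl : OrdGE l 0 := ordGE_of_analyticAt hc.analytic_l
    simp only [hEig_succ_zero, hEig_succ_one]
    constructor
    · simpa using (hl.mul h0).add (by simpa using h1.const_mul _)
    · simpa using (h0.const_mul _).add (by simpa using hl.mul h1)

/-- At `𝔭(γ²)` every step of the flow raises the order of `h₊(m, λ)`. -/
lemma ordGE_hEig_gamma (s : Setting α γ ε z₀ κ zk m) (hc : AffineChart hR ζ₀ ξ₀ h l x)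
    (hl0 : l 0 = γ) (hξ : ξ₀ = xiGamma α γ ε κ z₀) (hm : 0 < m) (hu0 : lowerPoly α z₀ ≠ 0) :
    ∀ i ≤ m, OrdGE (fun t => hEig α γ ε z₀ 1 i (l t) (rho α κ (l t) (x t)) 0) i ∧
      OrdGE (fun t => hEig α γ ε z₀ 1 i (l t) (rho α κ (l t) (x t)) 1) i := by
  have hζ : ζ₀ = γ ^ 2 := by rw [← hc.l_sq, hl0]
  have hUne : ∀ i < m, (lowerPoly α (flow α γ ε z₀ i)).eval (γ ^ 2) ≠ 0 := fun i hi => by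
    rw [← L10_mul _ s.alphaFun_γ_ne]
    exact mul_ne_zero (s.flow_def i hi).1 s.alphaFun_γ_ne
  -- the ratio of the components of the eigenvector
  let c : ℕ → ℂ → ℂ := fun i t =>
    (l t ^ 2 * (diagPoly α (flow α γ ε z₀ i)).eval (l t ^ 2) + κ * x t) * (l t)⁻¹ *
      ((lowerPoly α (flow α γ ε z₀ i)).eval (l t ^ 2))⁻¹
  have hU : ∀ i < m, HasOrd (fun t => (lowerPoly α (flow α γ ε z₀ i)).eval (l t ^ 2)) 0 :=
    fun i hi => hasOrd_of_analyticAt (hc.analyticAt_eval _) (by rw [hl0]; exact hUne i hi)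
  have hcO : ∀ i < m, OrdGE (c i) 0 := fun i hi => by
    simpa using (hc.eigen_ordGE_zero curvePoly_eval_zero κ
      (diagPoly α (flow α γ ε z₀ i))).mul (hU i hi).inv.ordGE
  have hce : ∀ i < m, (fun t => hEig α γ ε z₀ 1 i (l t) (rho α κ (l t) (x t)) 0) =ᶠ[𝓝[≠] 0]
      fun t => c i t * hEig α γ ε z₀ 1 i (l t) (rho α κ (l t) (x t)) 1 := fun i hi => by
    filter_upwards [hc.eventually_regular hu0, (hU i hi).eventually_ne] with t ⟨t1, t2, t3⟩ t4
    have := (s.mono hi.le).hEig_mul_lower t1 t2 t3 (hc.sq_eq t)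
    rw [← eq_mul_inv_iff_mul_eq₀ t4] at this
    rw [this]
    simp only [c]
    ring
  -- These are the components of the Darboux matrix applied to `(c_i, 1)`. Both vanish at `𝔭(γ²)`
  -- because `c_i = -b_i` there.
  have hfac : ∀ i < m, OrdGE (fun t => l t * c i t + γ * bSeq α γ ε z₀ i) 1 ∧
      OrdGE (fun t => γ * (bSeq α γ ε z₀ i)⁻¹ * c i t + l t) 1 := fun i hi => by
    -- For `γ = 0` the formula for `c i` contains `1/λ` with `λ → 0`, so only its order bound is
    -- available; the two factors are then `λ c_i` and `λ`.
    by_cases h0 : γ = 0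
    · have hl1 : OrdGE l 1 := ordGE_one_of_analyticAt hc.analytic_l (by rw [hl0, h0])
      simpa [h0] using And.intro (by simpa using hl1.mul (hcO i hi)) hl1
    · have hl := hc.analytic_l
      have hca : AnalyticAt ℂ (c i) 0 :=
        ((((hl.pow 2).mul (hc.analyticAt_eval _)).add (analyticAt_const.mul hc.analytic_x)).mul
          (hl.inv (by rwa [hl0]))).mul ((hc.analyticAt_eval _).inv (by rw [hl0]; exact hUne i hi))
      have hb : bSeq α γ ε z₀ i ≠ 0 := (s.flow_def i hi).2
      have hc0 : c i 0 = -bSeq α γ ε z₀ i := by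
        have h1 : bSeq α γ ε z₀ i * _ = _ := fGamma_mul (ε := ε) (s.flow_def i hi).1
        have h2 := s.κ_mul_xiGamma
        -- Invariance of `𝓕_γ` makes the same root `√(-𝓕_γ)`, with the same sign `ε`, appear at
        -- every step, so one point `𝔭(γ²)` serves for all `i`.
        rw [(s.mono hi.le).genF_flow s.alphaFun_γ_ne] at h1
        have h3 : L α γ (flow α γ ε z₀ i) 1 0 =
            Q α γ (α * (flow α γ ε z₀ i).2) (flow α γ ε z₀ i).2 := by simp [L]
        have h4 : L α γ (flow α γ ε z₀ i) 0 0 =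
            γ * Q α γ (flow α γ ε z₀ i).1 (flow α γ ε z₀ i).2 := by simp [L]
        have h5 := L10_mul (flow α γ ε z₀ i) s.alphaFun_γ_ne
        have h6 := L00_mul (flow α γ ε z₀ i) s.alphaFun_γ_ne
        rw [h3] at h5
        rw [h4] at h6
        simp only [c]
        rw [hl0, hc.x_zero, hξ, mul_inv_eq_iff_eq_mul₀ (hUne i hi), mul_inv_eq_iff_eq_mul₀ h0]
        linear_combination h2 - γ * h6 + γ * alphaFun α (γ ^ 2) * h1
          - γ * bSeq α γ ε z₀ i * h5
      refine ⟨ordGE_one_of_analyticAt ((hl.mul hca).add analyticAt_const) ?_,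
        ordGE_one_of_analyticAt ((analyticAt_const.mul hca).add hl) ?_⟩
      · simp only [hc0, hl0]
        ring
      · simp only [hc0, hl0]
        field_simp
        ring
  intro i
  induction i with
  | zero =>
    intro _
    have h1 : OrdGE (fun t => hEig α γ ε z₀ 1 0 (l t) (rho α κ (l t) (x t)) 1) 0 := by
      simpa [hEig_zero] using ordGE_const 1
    refine ⟨?_, h1⟩
    simpa using ((hcO 0 hm).mul h1).congr (hce 0 hm).symm
  | succ i ih =>
    intro hi
    obtain ⟨-, h1⟩ := ih (by omega)
    obtain ⟨f0, f1⟩ := hfac i hi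
    simp only [hEig_succ_zero, hEig_succ_one]
    constructor
    · refine ((f0.mul h1).congr ?_).mono (by push_cast; omega)
      filter_upwards [hce i hi] with t ht
      rw [ht]
      ring
    · refine ((f1.mul h1).congr ?_).mono (by push_cast; omega)
      filter_upwards [hce i hi] with t ht
      rw [ht]
      ring

end Affine

/-- The point `𝔭(ν²)`. -/
def nuPt {z : Phase (g + 1)} {nu : Fin g → ℂ}
    (hxi : ∀ j, xiNu α κ z (nu j) ^ 2 = (curvePoly α zk).eval (nu j)) (j : Fin g) :
    Pt (curvePoly α zk) := .affine (nu j) (xiNu α κ z (nu j)) (hxi j)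

section Bounds

variable {nu0 num : Fin g → ℂ}

/-- Lower bound for the order of the Baker function at an affine point. -/
theorem ordGE_baker_affine (s : Setting α γ ε z₀ κ zk m) (hR : Squarefree (curvePoly α zk))
    (hA0 : Aqq α z₀ ≠ 0) (hAm : Aqq α (flow α γ ε z₀ m) ≠ 0)
    (hnu0 : IsElliptic α z₀ nu0) (hnum : IsElliptic α (flow α γ ε z₀ m) num)
    (h0 : ∀ j, xiNu α κ z₀ (nu0 j) ^ 2 = (curvePoly α zk).eval (nu0 j))
    (hm : ∀ j, xiNu α κ (flow α γ ε z₀ m) (num j) ^ 2 = (curvePoly α zk).eval (num j))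
    (ζ₀ ξ₀ : ℂ) (h : ξ₀ ^ 2 = (curvePoly α zk).eval ζ₀) :
    OrdGE (fun t => baker α γ ε κ z₀ zk m (localParam hR (.affine ζ₀ ξ₀ h) t))
      (∑ j, mult (nuPt hm j) (.affine ζ₀ ξ₀ h) - ∑ j, mult (nuPt h0 j) (.affine ζ₀ ξ₀ h)
        + m * mult (.affine (γ ^ 2) (xiGamma α γ ε κ z₀) s.xiGamma_sq) (.affine ζ₀ ξ₀ h)
        + (if Even m then 0 else 1) * mult (origin α zk) (.affine ζ₀ ξ₀ h)) := by
  have hu := hnu0.lowerPoly_eq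
  have hu' := hnum.lowerPoly_eq
  have hu0 : lowerPoly α z₀ ≠ 0 := by
    rw [hu]
    exact mul_ne_zero (C_ne_zero.mpr hA0)
      (monic_prod_of_monic _ _ fun _ _ => monic_X_sub_C _).ne_zero
  have root : ∀ (z : Phase (g + 1)) (nu : Fin g → ℂ),
      lowerPoly α z = C (Aqq α z) * ∏ j, (X - C (nu j)) → ∀ j,
      (lowerPoly α z).eval (nu j) = 0 := fun z nu e j => by
    rw [e, eval_mul, eval_prod, Finset.prod_eq_zero (Finset.mem_univ j) (by simp), mul_zero]
  have s0 := s.mono (Nat.zero_le m)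
  -- Over `γ²` the root of `ζ` must be `γ` itself, since both the Darboux matrix and the sign of
  -- `𝔭(γ²)` refer to `γ`.
  obtain ⟨l₀, hl₀, hγl⟩ : ∃ l₀, l₀ ^ 2 = ζ₀ ∧ (ζ₀ = γ ^ 2 → l₀ = γ) := by
    by_cases e : ζ₀ = γ ^ 2
    · exact ⟨γ, e.symm, fun _ => rfl⟩
    · exact ⟨_, sq_cpow_half ζ₀, fun e' => absurd e' e⟩
  obtain ⟨l, x, hl, hc⟩ := exists_affineChart hR curvePoly_eval_zero ζ₀ ξ₀ h l₀ hl₀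
  have hn := sum_mult_nonneg (nuPt hm) (.affine ζ₀ ξ₀ h)
  -- both components of `h₊(m, λ)`
  have hB : OrdGE (fun t => hEig α γ ε z₀ 1 m (l t) (rho α κ (l t) (x t)) 0)
        (-∑ j, mult (nuPt h0 j) (.affine ζ₀ ξ₀ h)
        + m * mult (.affine (γ ^ 2) (xiGamma α γ ε κ z₀) s.xiGamma_sq) (.affine ζ₀ ξ₀ h)) ∧
      OrdGE (fun t => hEig α γ ε z₀ 1 m (l t) (rho α κ (l t) (x t)) 1)
        (-∑ j, mult (nuPt h0 j) (.affine ζ₀ ξ₀ h)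
        + m * mult (.affine (γ ^ 2) (xiGamma α γ ε κ z₀) s.xiGamma_sq) (.affine ζ₀ ξ₀ h)) := by
    by_cases e : (m : ℤ) *
        mult (.affine (γ ^ 2) (xiGamma α γ ε κ z₀) s.xiGamma_sq) (.affine ζ₀ ξ₀ h) = 0
    · rw [e, add_zero]
      exact ordGE_hEig s0 hc hA0 hu hu0 h0 (fun j => s.κ_mul_xiNu (root _ _ hu j)) m
    · have hm0 : 0 < m := Nat.pos_of_ne_zero fun e' => e (by simp [e'])
      have hP : Pt.affine ζ₀ ξ₀ h = .affine (γ ^ 2) (xiGamma α γ ε κ z₀) s.xiGamma_sq := by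
        by_contra e'
        exact e (by rw [mult_of_ne e', mul_zero])
      obtain ⟨e1, e2⟩ := Pt.affine_inj.mp hP
      -- No pole can sit at `𝔭(γ²)`: definedness of the first step gives `u_0(γ²) ≠ 0`.
      have h1 : ∑ j, mult (nuPt h0 j) (.affine ζ₀ ξ₀ h) = 0 := by
        refine Finset.sum_eq_zero fun j _ => mult_of_ne fun e' => ?_
        have h2 : L α γ z₀ 1 0 * _ = _ := L10_mul z₀ s.alphaFun_γ_ne
        rw [← e1, (Pt.affine_inj.mp e').1, root _ _ hu j, ← (Pt.affine_inj.mp e').1, e1] at h2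
        exact mul_ne_zero (s.flow_def 0 hm0).1 s.alphaFun_γ_ne h2
      have h3 := ordGE_hEig_gamma s hc (hl.trans (hγl e1)) e2 hm0 hu0 m le_rfl
      rw [h1, hP, mult_self]
      simpa using h3
  set B := -∑ j, mult (nuPt h0 j) (.affine ζ₀ ξ₀ h)
        + m * mult (.affine (γ ^ 2) (xiGamma α γ ε κ z₀) s.xiGamma_sq) (.affine ζ₀ ξ₀ h) with hBdef
  have hH : OrdGE (fun t => hEig α γ ε z₀ 1 m (l t) (rho α κ (l t) (x t)) 1)
      (B + ∑ j, mult (nuPt hm j) (.affine ζ₀ ξ₀ h)) := by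
    -- At a point `𝔭(ν²(m))`, `h⁽²⁾` is recovered as `h⁽¹⁾ u_m` divided by `(ζ a_m + κ ξ) / λ`. The
    -- divisor absorbs at most the conjugate multiplicity in `u_m`, so the zeros belonging to the
    -- point itself survive.
    by_cases e : ∑ j, mult (nuPt hm j) (.affine ζ₀ ξ₀ h) = 0
    · rw [e, add_zero]
      exact hB.2
    · obtain ⟨k, hk, hE⟩ := (hc.eigen_ord curvePoly_eval_zero s.κ_ne s.curve_eq hAm hu' hm
        (fun j => s.κ_mul_xiNu (root _ _ hu' j))).2 e
      have hU := hc.hasOrd_lower hAm hu' hm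
      change HasOrd _ (∑ j, mult (nuPt hm j) (.affine ζ₀ ξ₀ h) +
        ∑ j, mult (nuPt hm j) (Pt.affine ζ₀ ξ₀ h).neg) at hU
      change k ≤ ∑ j, mult (nuPt hm j) (Pt.affine ζ₀ ξ₀ h).neg at hk
      refine (OrdGE.of_mul (hB.1.mul hU.ordGE) hE ?_).mono (by omega)
      filter_upwards [hc.eventually_regular hu0] with t ⟨t1, t2, t3⟩
      exact (s.hEig_mul_lower t1 t2 t3 (hc.sq_eq t)).symm
  have hlam : OrdGE (fun t => if Even m then 1 else l t)
      ((if Even m then 0 else 1) * mult (origin α zk) (.affine ζ₀ ξ₀ h)) := by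
    split_ifs with hev
    · simpa using ordGE_const 1
    · by_cases e : Pt.affine ζ₀ ξ₀ h = origin α zk
      · rw [e, mult_self]
        simpa using (hc.ord_l (Pt.affine_inj.mp e).1).ordGE
      · rw [mult_of_ne e]
        simpa using ordGE_of_analyticAt hc.analytic_l
  refine ((hlam.mul hH).congr (Eventually.of_forall fun t => ?_)).mono (by omega)
  obtain ⟨h', e⟩ := hc.param t
  dsimp only
  rw [e, baker_apply]

/-- Lower bound for the order of the Baker function at the points at infinity. -/
theorem ordGE_baker_infty (s : Setting α γ ε z₀ κ zk m) (hR : Squarefree (curvePoly α zk))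
    (hA0 : Aqq α z₀ ≠ 0) (hnu0 : IsElliptic α z₀ nu0) (r : ℤˣ) :
    OrdGE (fun t => baker α γ ε κ z₀ zk m (localParam hR (.infty r) t))
      (-((m + 1) / 2 : ℕ)) := by
  have hu := hnu0.lowerPoly_eq
  have hu0 : lowerPoly α z₀ ≠ 0 := by
    rw [hu]
    exact mul_ne_zero (C_ne_zero.mpr hA0)
      (monic_prod_of_monic _ _ fun _ _ => monic_X_sub_C _).ne_zero
  obtain ⟨x, hx, hpar⟩ := exists_inftyChart hR curvePoly_monic natDegree_curvePoly r
  -- In the coordinate `t = 1/ζ` the root of `ζ` is not meromorphic. Only combinations even in `λ`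
  -- are bounded below: `λ h⁽¹⁾`, `h⁽²⁾` at even times and `h⁽¹⁾`, `λ h⁽²⁾` at odd times.
  let l : ℂ → ℂ := fun t => t⁻¹ ^ (1 / 2 : ℂ)
  have hl : ∀ t, l t ^ 2 = t⁻¹ := fun t => sq_cpow_half _
  have hinv : OrdGE (fun t => t⁻¹) (-1) := hasOrd_id.inv.ordGE
  have hreg : ∀ {p : ℂ[X]}, p ≠ 0 → ∀ᶠ t in 𝓝[≠] (0 : ℂ), p.eval t⁻¹ ≠ 0 :=
    eventually_eval_ne_zero fun c => ⟨_, hasOrd_inv_sub c⟩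
  have hU : HasOrd (fun t => (lowerPoly α z₀).eval t⁻¹) (-g) := by
    rw [hu]
    simp only [eval_mul, eval_C, eval_prod, eval_sub, eval_X]
    have := (HasOrd.prod Finset.univ fun j _ => hasOrd_inv_sub (nu0 j)).const_mul hA0
    simpa using this
  have hV : OrdGE (fun t => (t⁻¹ * (diagPoly α z₀).eval t⁻¹ + κ * x t) *
      ((lowerPoly α z₀).eval t⁻¹)⁻¹) (-1) := by
    have ha : OrdGE (fun t => (diagPoly α z₀).eval t⁻¹) (-g) :=
      ordGE_eval_inv _ (natDegree_numer_le _)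
    have h1 := ((hinv.mul ha).mono (show -((g + 1 : ℕ) : ℤ) ≤ _ by push_cast; omega)).add
      (hx.ordGE.const_mul κ)
    exact (h1.mul hU.inv.ordGE).mono (by push_cast; omega)
  have h00 : OrdGE (fun t => l t * hEig α γ ε z₀ 1 0 (l t) (rho α κ (l t) (x t)) 0) (-1) := by
    refine hV.congr ?_
    filter_upwards [hreg hu0, hreg (alphaPoly_monic (α := α)).ne_zero, self_mem_nhdsWithin]
      with t t1 t2 t3
    have hlt : l t ≠ 0 := fun e => inv_ne_zero t3 (by rw [← hl, e]; ring)
    obtain ⟨h', -⟩ := hpar t t3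
    rw [alphaPoly_eval] at t2
    rw [← hl] at t1 t2 h' ⊢
    have := (s.mono (Nat.zero_le m)).hEig_mul_lower hlt t2 t1 h'
    rw [show flow α γ ε z₀ 0 = z₀ from rfl] at this
    rw [mul_inv_eq_iff_eq_mul₀ t1, mul_assoc, this]
    simp only [hEig_zero, Matrix.cons_val_one, Matrix.cons_val_fin_one]
    field_simp
  -- The step to odd time keeps the bound `-(k + 1)`; the next step lowers the `λ h⁽¹⁾` bound by one
  -- through `λ² = 1/t`. Hence the pole order grows once per two steps.
  have odd_of_even : ∀ k : ℕ,
      OrdGE (fun t => l t * hEig α γ ε z₀ 1 (2 * k) (l t) (rho α κ (l t) (x t)) 0) (-(k + 1)) →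
      OrdGE (fun t => hEig α γ ε z₀ 1 (2 * k) (l t) (rho α κ (l t) (x t)) 1) (-k) →
      OrdGE (fun t => hEig α γ ε z₀ 1 (2 * k + 1) (l t) (rho α κ (l t) (x t)) 0) (-(k + 1)) ∧
      OrdGE (fun t => l t * hEig α γ ε z₀ 1 (2 * k + 1) (l t) (rho α κ (l t) (x t)) 1)
        (-(k + 1)) := fun k h0 h1 => by
    simp only [hEig_succ_zero, hEig_succ_one]
    refine ⟨h0.add ((h1.mono (by omega)).const_mul _), ?_⟩
    refine ((h0.const_mul (γ * (bSeq α γ ε z₀ (2 * k))⁻¹)).add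
      ((hinv.mul h1).mono (by omega))).congr (Eventually.of_forall fun t => ?_)
    dsimp only
    rw [← hl t]
    ring
  have even : ∀ k : ℕ,
      OrdGE (fun t => l t * hEig α γ ε z₀ 1 (2 * k) (l t) (rho α κ (l t) (x t)) 0) (-(k + 1)) ∧
      OrdGE (fun t => hEig α γ ε z₀ 1 (2 * k) (l t) (rho α κ (l t) (x t)) 1) (-k) := by
    intro k
    induction k with
    | zero => exact ⟨by simpa using h00, by simpa [hEig_zero] using ordGE_const 1⟩
    | succ k ih =>
      obtain ⟨h0, h1⟩ := odd_of_even k ih.1 ih.2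
      rw [show 2 * (k + 1) = 2 * k + 1 + 1 by ring]
      simp only [hEig_succ_zero _ _ _ (2 * k + 1), hEig_succ_one _ _ _ (2 * k + 1)]
      push_cast
      refine ⟨?_, ((h0.const_mul _).add h1).mono (by omega)⟩
      refine (((hinv.mul h0).mono (by omega)).add
        ((h1.const_mul (γ * bSeq α γ ε z₀ (2 * k + 1))).mono (by omega))).congr
          (Eventually.of_forall fun t => ?_)
      dsimp only
      rw [← hl t]
      ring
  have hmain : OrdGE (fun t => (if Even m then 1 else l t) *
      hEig α γ ε z₀ 1 m (l t) (rho α κ (l t) (x t)) 1) (-((m + 1) / 2 : ℕ)) := by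
    rcases Nat.even_or_odd' m with ⟨k, rfl | rfl⟩
    · simp only [even_two_mul, if_true, one_mul]
      exact (even k).2.mono (by omega)
    · have : ¬ Even (2 * k + 1) := by simp
      simp only [this, if_false]
      exact (odd_of_even k (even k).1 (even k).2).2.mono (by omega)
  refine hmain.congr ?_
  filter_upwards [self_mem_nhdsWithin] with t ht
  obtain ⟨h', e⟩ := hpar t ht
  rw [e]
  have h'' := h'
  rw [← hl] at h''
  rw [← baker_apply (l t) (x t) h'']
  exact congrArg _ (Pt.affine_congr _ (hl t) rfl)

end Bounds

end Local

/-! ### Assembling the divisor. -/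

section Divisor

open Filter Topology

variable {g : ℕ} {α : Fin (g + 1) → ℂ} {γ ε : ℂ} {z₀ : Phase (g + 1)} {κ : ℂ}
  {zk : Fin g → ℂ} {m : ℕ} {nu0 num : Fin g → ℂ}

/-- The divisor of the Baker function. -/
def bakerDivisor (pγ : Pt (curvePoly α zk)) (p0 pm : Fin g → Pt (curvePoly α zk)) (m : ℕ) :
    Pt (curvePoly α zk) →₀ ℤ :=
  (∑ j, (Finsupp.single (pm j) 1 - Finsupp.single (p0 j) 1))
    + (m : ℤ) • Finsupp.single pγ 1
    + (if Even m then 0 else 1 : ℤ) • Finsupp.single (origin α zk) 1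
    - (((m + 1) / 2 : ℕ) : ℤ) • (Finsupp.single (Pt.infty 1) 1 + Finsupp.single (Pt.infty (-1)) 1)

lemma bakerDivisor_apply (pγ : Pt (curvePoly α zk)) (p0 pm : Fin g → Pt (curvePoly α zk)) (m : ℕ)
    (P : Pt (curvePoly α zk)) : bakerDivisor pγ p0 pm m P =
      ∑ j, mult (pm j) P - ∑ j, mult (p0 j) P + m * mult pγ P
        + (if Even m then 0 else 1) * mult (origin α zk) P
        - ((m + 1) / 2 : ℕ) * (mult (Pt.infty 1) P + mult (Pt.infty (-1)) P) := by
  simp only [bakerDivisor, Finsupp.sub_apply, Finsupp.add_apply, Finsupp.smul_apply,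
    Finsupp.finsetSum_apply, Finset.sum_sub_distrib, smul_eq_mul, mult]

lemma hasOrd_norm {ζ : ℂ → ℂ} {nγ n0 nm no : ℤ} (h0 : HasOrd (fun t => ζ t) no)
    (hγ : HasOrd (fun t => ζ t - γ ^ 2) nγ)
    (hm : HasOrd (fun t => (lowerPoly α (flow α γ ε z₀ m)).eval (ζ t)) nm)
    (hn : HasOrd (fun t => (lowerPoly α z₀).eval (ζ t)) n0) :
    HasOrd (fun t => (if Even m then 1 else ζ t) * ((ζ t - γ ^ 2) ^ m *
        (lowerPoly α (flow α γ ε z₀ m)).eval (ζ t) * ((lowerPoly α z₀).eval (ζ t))⁻¹))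
      ((if Even m then 0 else 1) * no + (m * nγ + nm + -n0)) := by
  refine HasOrd.mul ?_ (((hγ.pow m).mul hm).mul hn.inv)
  split_ifs
  · simpa using hasOrd_const one_ne_zero
  · simpa using h0

/-- The divisor of the Baker function `H⁽²⁾(m, ·)`. -/
theorem hasDivisor_baker (s : Setting α γ ε z₀ κ zk m) (hR : Squarefree (curvePoly α zk))
    (hA0 : Aqq α z₀ ≠ 0) (hAm : Aqq α (flow α γ ε z₀ m) ≠ 0)
    (hnu0 : IsElliptic α z₀ nu0) (hnum : IsElliptic α (flow α γ ε z₀ m) num)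
    (h0 : ∀ j, xiNu α κ z₀ (nu0 j) ^ 2 = (curvePoly α zk).eval (nu0 j))
    (hm : ∀ j, xiNu α κ (flow α γ ε z₀ m) (num j) ^ 2 = (curvePoly α zk).eval (num j)) :
    HasDivisor hR (baker α γ ε κ z₀ zk m)
      (bakerDivisor (.affine (γ ^ 2) (xiGamma α γ ε κ z₀) s.xiGamma_sq) (nuPt h0) (nuPt hm) m) := by
  have hu := hnu0.lowerPoly_eq
  have hu' := hnum.lowerPoly_eq
  have hu0 : lowerPoly α z₀ ≠ 0 := by
    rw [hu]
    exact mul_ne_zero (C_ne_zero.mpr hA0)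
      (monic_prod_of_monic _ _ fun _ _ => monic_X_sub_C _).ne_zero
  have infty_ne : ∀ (r : ℤˣ) (ζ ξ : ℂ) (h : ξ ^ 2 = (curvePoly α zk).eval ζ),
      mult (.affine ζ ξ h) (.infty r) = 0 := fun r ζ ξ h => mult_of_ne (by simp)
  have affine_ne : ∀ (r : ℤˣ) (ζ ξ : ℂ) (h : ξ ^ 2 = (curvePoly α zk).eval ζ),
      mult (.infty r) (.affine ζ ξ h) = 0 := fun r ζ ξ h => mult_of_ne (by simp)
  have hsum : ∀ r : ℤˣ, mult (R := curvePoly α zk) (.infty 1) (.infty r) +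
      mult (.infty (-1)) (.infty r) = 1 := fun r => by
    have h1 : (Pt.infty 1 : Pt (curvePoly α zk)) ≠ .infty (-1) := by simp
    rcases Int.units_eq_one_or r with rfl | rfl
    · rw [mult_self, mult_of_ne h1, add_zero]
    · rw [mult_self, mult_of_ne h1.symm, zero_add]
  have hinf : ∀ r : ℤˣ, bakerDivisor (.affine (γ ^ 2) (xiGamma α γ ε κ z₀) s.xiGamma_sq)
      (nuPt h0) (nuPt hm) m (.infty r) = -((m + 1) / 2 : ℕ) := fun r => by
    rw [bakerDivisor_apply, hsum]
    simp only [nuPt, origin, infty_ne]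
    simp
  have haff : ∀ (ζ ξ : ℂ) (h : ξ ^ 2 = (curvePoly α zk).eval ζ),
      bakerDivisor (.affine (γ ^ 2) (xiGamma α γ ε κ z₀) s.xiGamma_sq)
      (nuPt h0) (nuPt hm) m (.affine ζ ξ h) =
      ∑ j, mult (nuPt hm j) (.affine ζ ξ h) - ∑ j, mult (nuPt h0 j) (.affine ζ ξ h)
        + m * mult (.affine (γ ^ 2) (xiGamma α γ ε κ z₀) s.xiGamma_sq) (.affine ζ ξ h)
        + (if Even m then 0 else 1) * mult (origin α zk) (.affine ζ ξ h) := fun ζ ξ h => by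
    rw [bakerDivisor_apply, affine_ne, affine_ne]
    ring
  refine hasDivisor_of_norm hR _ _ ?_ ?_
  · rintro (⟨ζ₀, ξ₀, h⟩ | ⟨r⟩)
    · rw [haff]
      exact ordGE_baker_affine s hR hA0 hAm hnu0 hnum h0 hm ζ₀ ξ₀ h
    · rw [hinf]
      exact ordGE_baker_infty s hR hA0 hnu0 r
  · rintro (⟨ζ₀, ξ₀, h⟩ | ⟨r⟩)
    · obtain ⟨l, x, -, hc⟩ := exists_affineChart hR curvePoly_eval_zero ζ₀ ξ₀ h _ (sq_cpow_half ζ₀)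
      -- With `ν = ξ = 0` this gives the order of `ζ` itself, which accounts for `𝔬` in the norm
      -- when `m` is odd.
      have key := hasOrd_norm (by simpa using hc.hasOrd_sub (ν := 0) (ξ := 0) (by simp [curvePoly]))
        (hc.hasOrd_sub s.xiGamma_sq) (hc.hasOrd_lower hAm hu' hm) (hc.hasOrd_lower hA0 hu h0)
      rw [Pt.neg_affine, haff, haff]
      refine HasOrd.of_eq ?_ (key.congr ?_)
      · simp only [Pt.neg_affine, nuPt, origin]
        ring
      · filter_upwards [hc.eventually_regular hu0] with t ⟨t1, t2, t3⟩
        obtain ⟨h', e⟩ := hc.param t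
        rw [e, baker_mul_baker_neg s (pow_ne_zero 2 t1) t2 t3 h']
    · obtain ⟨x, -, hpar⟩ := exists_inftyChart hR curvePoly_monic natDegree_curvePoly r
      have hU : ∀ (z : Phase (g + 1)) (nu : Fin g → ℂ), Aqq α z ≠ 0 →
          lowerPoly α z = C (Aqq α z) * ∏ j, (X - C (nu j)) →
          HasOrd (fun t => (lowerPoly α z).eval t⁻¹) (-g) := fun z nu hA hz => by
        rw [hz]
        simp only [eval_mul, eval_C, eval_prod, eval_sub, eval_X]
        simpa using (HasOrd.prod Finset.univ fun j _ => hasOrd_inv_sub (nu j)).const_mul hA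
      -- Both `u_m` and `u_0` have degree exactly `g`, as the leading coefficients `⟨Aq, q⟩` are
      -- non-zero; their orders cancel, leaving `-m`, or `-m - 1` for odd `m`.
      have key := hasOrd_norm hasOrd_id.inv (hasOrd_inv_sub (γ ^ 2)) (hU _ _ hAm hu')
        (hU _ _ hA0 hu)
      have hreg : ∀ {p : ℂ[X]}, p ≠ 0 → ∀ᶠ t in 𝓝[≠] (0 : ℂ), p.eval t⁻¹ ≠ 0 :=
        eventually_eval_ne_zero fun c => ⟨_, hasOrd_inv_sub c⟩
      rw [Pt.neg, hinf, hinf]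
      refine HasOrd.of_eq ?_ (key.congr ?_)
      · split_ifs with hev
        · obtain ⟨k, rfl⟩ := hev
          push_cast
          omega
        · obtain ⟨k, rfl⟩ := Nat.not_even_iff_odd.mp hev
          push_cast
          omega
      · filter_upwards [hreg hu0, hreg (alphaPoly_monic (α := α)).ne_zero, self_mem_nhdsWithin]
          with t t1 t2 t3
        obtain ⟨h', e⟩ := hpar t t3
        rw [e, baker_mul_baker_neg s (inv_ne_zero t3) (by rwa [alphaPoly_eval] at t2) t1 h']

end Divisor

end LSKdV

end

/-! ### The theorem, split by the parity of `m`. -/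

open LSKdV in
theorem proposition3p6 {g : ℕ}
    (α : Fin (g + 1) → ℂ) (hα0 : ∀ j, α j ≠ 0) (hα : Function.Injective fun j => α j ^ 2)
    (γ ε : ℂ) (hγ : ∀ j, γ ^ 2 ≠ α j ^ 2) (hε : ε = 1 ∨ ε = -1)
    (z₀ : Phase (g + 1)) (hF1 : F1 α z₀ ≠ 0)
    (κ : ℂ) (hκ : κ ^ 2 = -F1 α z₀)
    (zk : Fin g → ℂ)
    (hzk : ∀ lam : ℂ, (∀ j, lam ^ 2 ≠ α j ^ 2) →
      genF α lam z₀ = F1 α z₀ * (∏ k, (lam ^ 2 - zk k)) / alphaFun α (lam ^ 2))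
    (hR : Squarefree (curvePoly α zk))
    (m : ℕ) (hflow : FlowDefined α γ ε z₀ m)
    (hA0 : Aqq α z₀ ≠ 0) (hAm : Aqq α (flow α γ ε z₀ m) ≠ 0)
    (nu0 num : Fin g → ℂ)
    (hnu0 : IsElliptic α z₀ nu0) (hnum : IsElliptic α (flow α γ ε z₀ m) num) :
    (∀ lam ξ : ℂ, lam ≠ 0 → ∀ h : ξ ^ 2 = (curvePoly α zk).eval (lam ^ 2),
      ∀ h' : (-ξ) ^ 2 = (curvePoly α zk).eval (lam ^ 2),
      (Even m →
        baker α γ ε κ z₀ zk m (.affine (lam ^ 2) ξ h) =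
          hEig α γ ε z₀ 1 m lam (rho α κ lam ξ) 1 ∧
        baker α γ ε κ z₀ zk m (.affine (lam ^ 2) (-ξ) h') =
          hEig α γ ε z₀ (-1) m lam (rho α κ lam ξ) 1) ∧
      (Odd m →
        baker α γ ε κ z₀ zk m (.affine (lam ^ 2) ξ h) =
          lam * hEig α γ ε z₀ 1 m lam (rho α κ lam ξ) 1 ∧
        baker α γ ε κ z₀ zk m (.affine (lam ^ 2) (-ξ) h') =
          lam * hEig α γ ε z₀ (-1) m lam (rho α κ lam ξ) 1)) ∧
    ∃ (h0 : ∀ j, xiNu α κ z₀ (nu0 j) ^ 2 = (curvePoly α zk).eval (nu0 j))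
      (hm : ∀ j, xiNu α κ (flow α γ ε z₀ m) (num j) ^ 2 = (curvePoly α zk).eval (num j))
      (hg : xiGamma α γ ε κ z₀ ^ 2 = (curvePoly α zk).eval (γ ^ 2)),
      (∀ k : ℕ, m = 2 * k →
        HasDivisor hR (baker α γ ε κ z₀ zk m)
          ((∑ j, (Finsupp.single (Pt.affine (num j) (xiNu α κ (flow α γ ε z₀ m) (num j)) (hm j)) 1
              - Finsupp.single (Pt.affine (nu0 j) (xiNu α κ z₀ (nu0 j)) (h0 j)) 1))
            + (2 * (k : ℤ)) • Finsupp.single (Pt.affine (γ ^ 2) (xiGamma α γ ε κ z₀) hg) 1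
            - (k : ℤ) • (Finsupp.single (Pt.infty 1) 1 + Finsupp.single (Pt.infty (-1)) 1))) ∧
      (∀ k : ℕ, m = 2 * k + 1 →
        HasDivisor hR (baker α γ ε κ z₀ zk m)
          ((∑ j, (Finsupp.single (Pt.affine (num j) (xiNu α κ (flow α γ ε z₀ m) (num j)) (hm j)) 1
              - Finsupp.single (Pt.affine (nu0 j) (xiNu α κ z₀ (nu0 j)) (h0 j)) 1))
            + (2 * (k : ℤ) + 1) • Finsupp.single (Pt.affine (γ ^ 2) (xiGamma α γ ε κ z₀) hg) 1
            + Finsupp.single (origin α zk) 1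
            - ((k : ℤ) + 1) • (Finsupp.single (Pt.infty 1) 1 + Finsupp.single (Pt.infty (-1)) 1))) := by
  have s : Setting α γ ε z₀ κ zk m := ⟨hα0, hα, hγ, hε, hF1, hκ, hzk, hflow⟩
  have root : ∀ (z : Phase (g + 1)) (nu : Fin g → ℂ), IsElliptic α z nu → ∀ j,
      (lowerPoly α z).eval (nu j) = 0 := fun z nu e j => by
    rw [e.lowerPoly_eq, eval_mul, eval_prod, Finset.prod_eq_zero (Finset.mem_univ j) (by simp),
      mul_zero]
  have h0 : ∀ j, xiNu α κ z₀ (nu0 j) ^ 2 = (curvePoly α zk).eval (nu0 j) :=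
    fun j => (s.mono (Nat.zero_le m)).xiNu_sq (root _ _ hnu0 j)
  have hm : ∀ j, xiNu α κ (flow α γ ε z₀ m) (num j) ^ 2 = (curvePoly α zk).eval (num j) :=
    fun j => s.xiNu_sq (root _ _ hnum j)
  have hdiv := hasDivisor_baker s hR hA0 hAm hnu0 hnum h0 hm
  refine ⟨fun lam ξ _ h h' => ⟨fun hev => ?_, fun hodd => ?_⟩, h0, hm, s.xiGamma_sq,
    fun k hk => ?_, fun k hk => ?_⟩
  · rw [baker_apply, baker_apply_neg, if_pos hev, one_mul, one_mul]
    exact ⟨rfl, rfl⟩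
  · rw [baker_apply, baker_apply_neg, if_neg (Nat.not_even_iff_odd.mpr hodd)]
    exact ⟨rfl, rfl⟩
  · convert hdiv using 1
    have e1 : Even m := hk ▸ even_two_mul k
    have e2 : (m + 1) / 2 = k := by omega
    have e3 : (m : ℤ) = 2 * k := by omega
    rw [bakerDivisor, if_pos e1, e2, e3, zero_smul, add_zero]
    rfl
  · convert hdiv using 1
    have e1 : ¬ Even m := by simp [hk]
    have e2 : (m + 1) / 2 = k + 1 := by omega
    have e3 : (m : ℤ) = 2 * k + 1 := by omega
    rw [bakerDivisor, if_neg e1, e2, e3, one_smul, Nat.cast_add, Nat.cast_one]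
    rfl
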